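/- **Conventions.** A real square matrix is *Hurwitz* if all its complex eigenvalues have negative real part; $(A,B)$ is *controllable* if $[B,AB,\dots,A^{n-1}B]$ has rank $n$; $(A,C)$ is *detectable* if $A-LC$ is Hurwitz for some $L$. A linear system $\dot x=Ax+R\zeta$, $y=Cx$ *has external gain* $\gamma>0$ if $A$ is Hurwitz and there are $P=P^{\top}>0$ and $\alpha,\beta>0$ with $\beta/\alpha=\gamma$ such that $V(x)=x^{\top}Px$ satisfies $\dot V\le-\alpha\|y\|^2+\beta\|\zeta\|^2$ along the system, for all $x,\zeta$. A linear controller *solves the $\gamma$-stabilization* of a system with perturbation $\zeta$ if the closed loop has external gain $\gamma$. The *number of SVD steps* of a controllable pair $(A,B)$ is the number $l$ of steps of the following algorithm: start from $(\Phi_0,\Gamma_0)=(A,B)$; stop at $j=l$ when $\Gamma_j$ has full row rank; otherwise take a singular value decomposition $\Gamma_j=U\begin{bmatrix}\Sigma&0\\0&0\end{bmatrix}H^{\top}$, $U=[\tilde U\ \bar U]$ orthogonal, with $\Sigma$ of size $\operatorname{rank}\Gamma_j$, and put $\Phi_{j+1}=\bar U^{\top}\Phi_j\bar U$, $\Gamma_{j+1}=\bar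 U^{\top}\Phi_j\tilde U$. **Setting** (for an arbitrary agent; the agent's index is dropped). Let $A(w)\in\mathbb R^{n\times n}$, $B(w)\in\mathbb R^{n\times m}$, $C(w)\in\mathbb R^{p\times n}$ depend on $w\in\mathbb R^{r}$, continuously at $w=0$; write $A=A(0)$, $B=B(0)$, $C=C(0)$, and let $B$ have full column rank, with pseudo-inverse $B^+$, $B^+B=I$. Let $A_o\in\mathbb R^{d\times d}$, $C_o\in\mathbb R^{p\times d}$, $B_o$, $C_\zeta$ be real matrices of compatible sizes. Assume that for all $w$ near $0$ $$\operatorname{rank}\begin{bmatrix}A(w)-\lambda I&B(w)\\C(w)&0\end{bmatrix}=n+m\quad\text{for every }\lambda\in\sigma(A_o),$$ and that $(X(w),U(w))$ solves the regulator equations $X(w)A_o=A(w)X(w)+B(w)U(w)$, $C_o=C(w)X(w)$. Let $s$ be the degree of the minimal polynomial of $A_o$, $\bar A_o$ its $s\times s$ companion matrix (ones on the superdiagonal, negated coefficients in the last row), $\bar C_o=[1\ 0\cdots0]$, $\Phi=I_m\otimes\bar A_o$, $\Psi=I_m\otimes\bar C_o$, and let $\Upsilon(w)$ be the matrix obtained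 by stacking, over the rows $U_j(w)$ of $U(w)$, the rows $U_j(w),U_j(w)A_o,\dots,U_j(w)A_o^{s-1}$. Let $M\in\mathbb R^{ms\times ms}$, $N\in\mathbb R^{ms\times m}$, and let $T$ be a nonsingular matrix with $T\Phi-MT=N\Psi$. Put $X=X(0)$, $R=-XB_oC_\zeta$ and $$\bar A=\begin{bmatrix}A&B\Psi T^{-1}\\0&M+N\Psi T^{-1}\end{bmatrix},\quad \bar B=\begin{bmatrix}B\\N\end{bmatrix},\quad \bar R=\begin{bmatrix}R\\NB^+R\end{bmatrix},\quad \bar C=[\,C\ \ 0\,],$$ $$\Delta(w)=\begin{bmatrix}A(w)-A&(B(w)-B)\Psi T^{-1}&B(w)-B&-(X(w)-X)B_oC_\zeta\\0&0&0&T(\Upsilon(0)-\Upsilon(w))B_oC_\zeta\end{bmatrix},\quad \bar\Delta(w)=[\,C(w)-C\ \ 0\,].$$ The agent combined with its modified internal model is the system with state $\mathcal X$, input $\bar u$, perturbation $\zeta$ and output $e$ $$\dot{\mathcal X}=\bar A\mathcal X+\bar B\bar u+\bar R\zeta+\Delta(w)\,\mathrm{col}(\mathcal X,\bar u,\zeta),\qquad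 e=\bar C\mathcal X+\bar\Delta(w)\mathcal X.\tag{1}$$ **Lemma.** Assume that $(A,B)$ is controllable, $(A,C)$ is detectable, and $CA^{j-1}B=0$ for $j=1,\dots,l$, where $l$ is the number of SVD steps of $(A,B)$. Assume that $M$ is Hurwitz and $(M,N)$ is controllable. Then for every $\gamma>0$ there is a matrix $K$ such that $u=Kx$ solves the $\gamma$-stabilization of $\dot x=Ax+Bu+R\zeta$, $y=Cx$, and such that the following holds. There are matrices $L$ with $\bar A-L\bar C$ Hurwitz, and for each such $L$ there is a neighbourhood $\mathbb W$ of $w=0$ such that, for all $w\in\mathbb W$, the $\gamma$-stabilization of (1) is solved by the output feedback controller $$\bar u=[\,K\ \ -\Psi T^{-1}\,]\chi,\qquad \dot\chi=\bar A\chi+L(e-\bar C\chi)+\bar B\bar u+\bar R\zeta .$$ -/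

import Mathlib

open Matrix Topology
open scoped Kronecker

/-- A real square matrix is Hurwitz: all its complex eigenvalues have negative real part. -/
def IsHurwitz {ι : Type*} [Fintype ι] [DecidableEq ι] (A : Matrix ι ι ℝ) : Prop :=
  ∀ μ ∈ spectrum ℂ (A.map Complex.ofReal), μ.re < 0

/-- The controllability matrix `[B, A B, …, A ^ (d - 1) B]`, with `d` the state dimension. -/
def ctrbMatrix {ι κ : Type*} [Fintype ι] [DecidableEq ι]
    (A : Matrix ι ι ℝ) (B : Matrix ι κ ℝ) : Matrix ι (Fin (Fintype.card ι) × κ) ℝ :=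
  Matrix.of fun i kj => (A ^ (kj.1 : ℕ) * B) i kj.2

/-- The pair `(A, B)` is controllable. -/
def IsControllable {ι κ : Type*} [Fintype ι] [DecidableEq ι] [Fintype κ]
    (A : Matrix ι ι ℝ) (B : Matrix ι κ ℝ) : Prop :=
  (ctrbMatrix A B).rank = Fintype.card ι

/-- The pair `(A, C)` is detectable: some output injection makes `A - L C` Hurwitz. -/
def IsDetectable {ι κ : Type*} [Fintype ι] [DecidableEq ι] [Fintype κ]
    (A : Matrix ι ι ℝ) (C : Matrix κ ι ℝ) : Prop :=
  ∃ L : Matrix ι κ ℝ, IsHurwitz (A - L * C)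

/-- The SVD algorithm started from the pair `(Φ, Γ)` reaches a pair whose second matrix has full
row rank after exactly `l` steps.

One step: if `Γ` (of size `n × m`) is nonzero and not of full row rank, take a singular value
decomposition `Γ = U [Σ 0; 0 0] Hᵀ` with `U = [U₁ U₂]` and `H` orthogonal and `Σ` diagonal with
positive diagonal entries, and pass to the pair `(U₂ᵀ Φ U₂, U₂ᵀ Φ U₁)`. -/
inductive SVDStepsTo : {n m : ℕ} → Matrix (Fin n) (Fin n) ℝ → Matrix (Fin n) (Fin m) ℝ → ℕ → Prop
  | done {n m : ℕ} (Φ : Matrix (Fin n) (Fin n) ℝ) (Γ : Matrix (Fin n) (Fin m) ℝ)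
      (hrank : Γ.rank = n) : SVDStepsTo Φ Γ 0
  | step {n m r n' m' l : ℕ} (Φ : Matrix (Fin n) (Fin n) ℝ) (Γ : Matrix (Fin n) (Fin m) ℝ)
      (U₁ : Matrix (Fin n) (Fin r) ℝ) (U₂ : Matrix (Fin n) (Fin n') ℝ)
      (H : Matrix (Fin m) (Fin r ⊕ Fin m') ℝ) (σ : Fin r → ℝ)
      (hrank : Γ.rank ≠ n) (hne : Γ ≠ 0)
      (hU : fromCols U₁ U₂ * (fromCols U₁ U₂)ᵀ = 1)
      (hU' : (fromCols U₁ U₂)ᵀ * fromCols U₁ U₂ = 1)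
      (hH : H * Hᵀ = 1) (hH' : Hᵀ * H = 1)
      (hσ : ∀ i, 0 < σ i)
      (hsvd : Γ = fromCols U₁ U₂ *
        (fromBlocks (diagonal σ) 0 0 0 : Matrix (Fin r ⊕ Fin n') (Fin r ⊕ Fin m') ℝ) * Hᵀ)
      (hnext : SVDStepsTo (U₂ᵀ * Φ * U₂) (U₂ᵀ * Φ * U₁) l) : SVDStepsTo Φ Γ (l + 1)

/-- The number of SVD steps of `(A, B)`. For a controllable pair the algorithm does reach full row
rank, and the number of steps does not depend on the chosen decompositions. -/
noncomputable def numSVDSteps {n m : ℕ}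
    (A : Matrix (Fin n) (Fin n) ℝ) (B : Matrix (Fin n) (Fin m) ℝ) : ℕ :=
  sInf {l | SVDStepsTo A B l}

/-- The system `ẋ = A x + R ζ`, `y = C x` has a Hurwitz matrix `A` and external gain `γ`: there
are a quadratic function `V x = xᵀ P x` with `P` symmetric positive definite and constants
`α, β > 0` with `β / α = γ` such that `V̇ ≤ - α ‖y‖² + β ‖ζ‖²` along the system. -/
def HasExternalGain {ι κ ρ : Type*} [Fintype ι] [DecidableEq ι] [Fintype κ] [Fintype ρ]
    (A : Matrix ι ι ℝ) (R : Matrix ι ρ ℝ) (C : Matrix κ ι ℝ) (γ : ℝ) : Prop :=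
  IsHurwitz A ∧
    ∃ P : Matrix ι ι ℝ, P.PosDef ∧ ∃ α β : ℝ, 0 < α ∧ 0 < β ∧ β / α = γ ∧
      ∀ (x : ι → ℝ) (ζ : ρ → ℝ),
        (A *ᵥ x + R *ᵥ ζ) ⬝ᵥ (P *ᵥ x) + x ⬝ᵥ (P *ᵥ (A *ᵥ x + R *ᵥ ζ)) ≤
          -α * ((C *ᵥ x) ⬝ᵥ (C *ᵥ x)) + β * (ζ ⬝ᵥ ζ)

/-- Degree `s` of the minimal polynomial of `Ao`. -/
noncomputable abbrev minDeg {d : ℕ} (Ao : Matrix (Fin d) (Fin d) ℝ) : ℕ :=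
  (minpoly ℝ Ao).natDegree

/-- The companion matrix `Āo` of the minimal polynomial of `Ao`: ones on the superdiagonal, and
last row `(-α_s, …, -α_1)` for the minimal polynomial `λ ^ s + α_1 λ ^ (s - 1) + ⋯ + α_s`. -/
noncomputable def companionOf {d : ℕ} (Ao : Matrix (Fin d) (Fin d) ℝ) :
    Matrix (Fin (minDeg Ao)) (Fin (minDeg Ao)) ℝ :=
  Matrix.of fun j k =>
    if (j : ℕ) + 1 = minDeg Ao then -(minpoly ℝ Ao).coeff k
    else if (k : ℕ) = j + 1 then 1 else 0

/-- `Φ = I_m ⊗ Āo`. -/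
noncomputable def imPhi {d : ℕ} (m : ℕ) (Ao : Matrix (Fin d) (Fin d) ℝ) :
    Matrix (Fin m × Fin (minDeg Ao)) (Fin m × Fin (minDeg Ao)) ℝ :=
  (1 : Matrix (Fin m) (Fin m) ℝ) ⊗ₖ companionOf Ao

/-- `Ψ = I_m ⊗ C̄o` with the row vector `C̄o = [1 0 ⋯ 0]`. -/
noncomputable def imPsi {d : ℕ} (m : ℕ) (Ao : Matrix (Fin d) (Fin d) ℝ) :
    Matrix (Fin m) (Fin m × Fin (minDeg Ao)) ℝ :=
  ((1 : Matrix (Fin m) (Fin m) ℝ) ⊗ₖ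
    (Matrix.of fun _ k => if (k : ℕ) = 0 then 1 else 0 :
      Matrix (Fin 1) (Fin (minDeg Ao)) ℝ)).submatrix (fun i => (i, 0)) id

/-- `Υ`: the rows `U_j, U_j Ao, …, U_j Ao ^ (s - 1)` for each row `U_j` of `U`, stacked. -/
noncomputable def imUpsilon {d m : ℕ} (Ao : Matrix (Fin d) (Fin d) ℝ)
    (U : Matrix (Fin m) (Fin d) ℝ) : Matrix (Fin m × Fin (minDeg Ao)) (Fin d) ℝ :=
  Matrix.of fun jk c => (U * Ao ^ (jk.2 : ℕ)) jk.1 c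

/-- The pair `(X, U)` solves the regulator equations `X Ao = A X + B U`, `Co = C X`. -/
def SolvesRegulator {n m p d : ℕ} (Ao : Matrix (Fin d) (Fin d) ℝ) (Co : Matrix (Fin p) (Fin d) ℝ)
    (A : Matrix (Fin n) (Fin n) ℝ) (B : Matrix (Fin n) (Fin m) ℝ) (C : Matrix (Fin p) (Fin n) ℝ)
    (X : Matrix (Fin n) (Fin d) ℝ) (U : Matrix (Fin m) (Fin d) ℝ) : Prop :=
  X * Ao = A * X + B * U ∧ Co = C * X

/-- `rank [A - μ I, B; C, 0] = n + m` for every eigenvalue `μ` of `Ao`. -/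
def ZeroRankCondition {n m p d : ℕ} (Ao : Matrix (Fin d) (Fin d) ℝ)
    (A : Matrix (Fin n) (Fin n) ℝ) (B : Matrix (Fin n) (Fin m) ℝ)
    (C : Matrix (Fin p) (Fin n) ℝ) : Prop :=
  ∀ μ ∈ spectrum ℂ (Ao.map Complex.ofReal),
    (fromBlocks (A.map Complex.ofReal - μ • (1 : Matrix (Fin n) (Fin n) ℂ))
      (B.map Complex.ofReal) (C.map Complex.ofReal) 0).rank = n + m

section Augmented

variable {ι κ ν ρ o : Type*} [Fintype ι] [DecidableEq ι] [Fintype κ] [Fintype ν] [DecidableEq ν]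
  [Fintype ρ] [Fintype o]

/-- `Ā = [A, B Q; 0, M + N Q]`. -/
def augA (A : Matrix ι ι ℝ) (B : Matrix ι κ ℝ) (M : Matrix ν ν ℝ) (N : Matrix ν κ ℝ)
    (Q : Matrix κ ν ℝ) : Matrix (ι ⊕ ν) (ι ⊕ ν) ℝ :=
  fromBlocks A (B * Q) 0 (M + N * Q)

/-- `B̄ = [B; N]`. -/
def augB (B : Matrix ι κ ℝ) (N : Matrix ν κ ℝ) : Matrix (ι ⊕ ν) κ ℝ :=
  fromRows B N

/-- `R̄ = [R; N B⁺ R]`. -/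
def augR (N : Matrix ν κ ℝ) (Bp : Matrix κ ι ℝ) (R : Matrix ι ρ ℝ) : Matrix (ι ⊕ ν) ρ ℝ :=
  fromRows R (N * Bp * R)

/-- `C̄ = [C, 0]`. -/
def augC (ν : Type*) (C : Matrix o ι ℝ) : Matrix o (ι ⊕ ν) ℝ :=
  fromCols C 0

/-- The state matrix of the closed loop, with state `col(x, χ)`, of the uncertain plant
`ẋ = Ā x + B̄ u + R̄ ζ + Δ col(x, u, ζ)`, `y = C̄ x + Δ̄ x` and the observer-based controller
`u = K̄ χ`, `χ̇ = Ā χ + L (y - C̄ χ) + B̄ u + R̄ ζ`. -/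
def closedA (Abar : Matrix ι ι ℝ) (Bbar : Matrix ι κ ℝ) (Cbar : Matrix o ι ℝ)
    (Δ : Matrix ι (ι ⊕ (κ ⊕ ρ)) ℝ) (Δbar : Matrix o ι ℝ)
    (Kbar : Matrix κ ι ℝ) (L : Matrix ι o ℝ) : Matrix (ι ⊕ ι) (ι ⊕ ι) ℝ :=
  fromBlocks (Abar + Δ.toCols₁) ((Bbar + Δ.toCols₂.toCols₁) * Kbar)
    (L * (Cbar + Δbar)) (Abar - L * Cbar + Bbar * Kbar)

/-- The perturbation input matrix of the same closed loop. -/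
def closedR (Rbar : Matrix ι ρ ℝ) (Δ : Matrix ι (ι ⊕ (κ ⊕ ρ)) ℝ) : Matrix (ι ⊕ ι) ρ ℝ :=
  fromRows (Rbar + Δ.toCols₂.toCols₂) Rbar

/-- The output matrix of the same closed loop. -/
def closedC (Cbar : Matrix o ι ℝ) (Δbar : Matrix o ι ℝ) : Matrix o (ι ⊕ ι) ℝ :=
  fromCols (Cbar + Δbar) 0

end Augmented

/-- The uncertainty matrix `Δ`, acting on `col(𝒳, ū, ζ)` with `𝒳 = col(x̄, η̄)`, from the nominal
data `A₀, B₀, X₀, Υ₀` and the actual data `A, B, X, Υ`; here `E = Bo Cζ` and `Q = Ψ T⁻¹`. -/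
def uncertainty {n m d q : ℕ} {ν : Type*} [Fintype ν]
    (A₀ A : Matrix (Fin n) (Fin n) ℝ) (B₀ B : Matrix (Fin n) (Fin m) ℝ)
    (X₀ X : Matrix (Fin n) (Fin d) ℝ) (Υ₀ Υ : Matrix ν (Fin d) ℝ)
    (T : Matrix ν ν ℝ) (Q : Matrix (Fin m) ν ℝ) (E : Matrix (Fin d) (Fin q) ℝ) :
    Matrix (Fin n ⊕ ν) ((Fin n ⊕ ν) ⊕ (Fin m ⊕ Fin q)) ℝ :=
  fromCols (fromBlocks (A - A₀) ((B - B₀) * Q) 0 0)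
    (fromBlocks (B - B₀) (-((X - X₀) * E)) 0 (T * (Υ₀ - Υ) * E))

/-! ### Quadratic storage functions and what their strict margin absorbs -/

section QuadraticEstimates

variable {ι κ ν ρ o : Type*} [Fintype ι] [Fintype κ] [Fintype ν] [Fintype ρ] [Fintype o]

/-! Everything runs through `StrictGain`, a dissipation inequality with a strict margin in `(x, ζ)`.
The margin pays for a change of coordinates, for attaching a Hurwitz subsystem in cascade, and for a
small perturbation of all the matrices. A gain certified for the nominal state feedback is thus
carried, with the same `γ`, to the uncertain closed loop.

The nominal gain is almost disturbance decoupling (`SVDStepsTo.exists_strictGain`). An SVD step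
splits off the part `U₁ᵀ x` of the state that the input actuates directly; this part serves as
virtual input of the compressed pair, and the vanishing of the products `C A ^ i B` keeps it out of
the output. Controllability makes the algorithm reach full row rank, where arbitrarily strong
damping can be assigned; on the way back each step is one high-gain backstepping. Hence every `γ >
0` is attained.

With `Q = Ψ T⁻¹`, the feedback `[K, -Q]` cancels the action of the internal model on the plant and
leaves the Hurwitz matrix `M` driven by it (`StrictGain.cascade_driving`). The observer is fed `R̄
ζ`, so its error obeys the undisturbed equation with matrix `Ā - L C̄` (`StrictGain.observer`). The
uncertainty vanishes at `w = 0` and is continuous there, because the regulator equations have a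
unique solution (`continuousAt_regulator`); `StrictGain.eventually` then gives the neighbourhood.

Gains `L` exist by the Popov–Belevitch–Hautus test: `M + N Q` is similar to `Φ`, whose eigenvalues
belong to `Ao`, where the rank condition excludes unobservable modes (`isDetectable_aug`). That test
and Lyapunov's theorem both follow from one separation argument (`exists_posDef_lmi`). -/

lemma dotProduct_self_nonneg_real (x : ι → ℝ) : 0 ≤ x ⬝ᵥ x :=
  Finset.sum_nonneg fun i _ => mul_self_nonneg (x i)

lemma dotProduct_self_pos_real {x : ι → ℝ} (hx : x ≠ 0) : 0 < x ⬝ᵥ x :=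
  lt_of_le_of_ne (dotProduct_self_nonneg_real x) fun h => hx (dotProduct_self_eq_zero.1 h.symm)

/-- The squared Frobenius norm bounds the squared operator norm. -/
lemma mulVec_dotProduct_mulVec_le (G : Matrix ι κ ℝ) (y : κ → ℝ) :
    (G *ᵥ y) ⬝ᵥ (G *ᵥ y) ≤ (∑ i, ∑ j, G i j ^ 2) * (y ⬝ᵥ y) := by
  rw [Finset.sum_mul]
  refine Finset.sum_le_sum fun i _ => ?_
  have h := Finset.sum_mul_sq_le_sq_mul_sq Finset.univ (G i) y
  simpa [mulVec, dotProduct, sq] using h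

lemma two_mul_dotProduct_le {τ : ℝ} (hτ : 0 < τ) (x y : ι → ℝ) :
    2 * (x ⬝ᵥ y) ≤ τ * (x ⬝ᵥ x) + τ⁻¹ * (y ⬝ᵥ y) := by
  simp only [dotProduct, Finset.mul_sum]
  rw [← Finset.sum_add_distrib]
  refine Finset.sum_le_sum fun i _ => ?_
  have h : 0 ≤ τ⁻¹ * (τ * x i - y i) ^ 2 := by positivity
  have h2 : τ⁻¹ * (τ * x i - y i) ^ 2 =
      τ * (x i * x i) + τ⁻¹ * (y i * y i) - 2 * (x i * y i) := by
    field_simp; ring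
  linarith

/-- Weighted Young inequality: a cross term costs an arbitrarily small share of one variable, at the
price of a large share of the other. The primed version exchanges the roles. -/
lemma exists_two_mul_dotProduct_mulVec_le (G : Matrix ι κ ℝ) {τ : ℝ} (hτ : 0 < τ) :
    ∃ c, 0 < c ∧ ∀ (x : ι → ℝ) (y : κ → ℝ),
      2 * (x ⬝ᵥ G *ᵥ y) ≤ τ * (x ⬝ᵥ x) + c * (y ⬝ᵥ y) := by
  have h0 : 0 ≤ ∑ i, ∑ j, G i j ^ 2 :=
    Finset.sum_nonneg fun i _ => Finset.sum_nonneg fun j _ => sq_nonneg _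
  refine ⟨τ⁻¹ * ((∑ i, ∑ j, G i j ^ 2) + 1), by positivity, fun x y => ?_⟩
  have h1 := two_mul_dotProduct_le hτ x (G *ᵥ y)
  have h2 := mul_le_mul_of_nonneg_left (mulVec_dotProduct_mulVec_le G y) (inv_pos.2 hτ).le
  have h3 := mul_nonneg (inv_pos.2 hτ).le (dotProduct_self_nonneg_real y)
  nlinarith

lemma exists_two_mul_dotProduct_mulVec_le' (G : Matrix ι κ ℝ) {τ : ℝ} (hτ : 0 < τ) :
    ∃ c, 0 < c ∧ ∀ (x : ι → ℝ) (y : κ → ℝ),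
      2 * (x ⬝ᵥ G *ᵥ y) ≤ c * (x ⬝ᵥ x) + τ * (y ⬝ᵥ y) := by
  obtain ⟨c, hc, h⟩ := exists_two_mul_dotProduct_mulVec_le Gᵀ hτ
  refine ⟨c, hc, fun x y => ?_⟩
  have := h y x
  rw [dotProduct_mulVec, vecMul_transpose, dotProduct_comm] at this
  linarith

lemma eventually_two_mul_dotProduct_mulVec_le {W : Type*} {l : Filter W} {G : W → Matrix ι κ ℝ}
    (hG : Filter.Tendsto G l (𝓝 0)) {τ : ℝ} (hτ : 0 < τ) :
    ∀ᶠ w in l, ∀ (x : ι → ℝ) (y : κ → ℝ),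
      2 * (x ⬝ᵥ G w *ᵥ y) ≤ τ * (x ⬝ᵥ x + y ⬝ᵥ y) := by
  have hc : Continuous fun M : Matrix ι κ ℝ => ∑ i, ∑ j, M i j ^ 2 := by fun_prop
  have ht := (hc.tendsto 0).comp hG
  simp only [Matrix.zero_apply, ne_eq, OfNat.ofNat_ne_zero, not_false_eq_true, zero_pow,
    Finset.sum_const_zero] at ht
  filter_upwards [ht.eventually_lt_const (show (0 : ℝ) < τ ^ 2 by positivity)] with w hw x y
  have h1 := two_mul_dotProduct_le hτ x (G w *ᵥ y)
  have h2 := mul_le_mul_of_nonneg_left (mulVec_dotProduct_mulVec_le (G w) y) (inv_pos.2 hτ).le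
  have h3 : τ⁻¹ * ((∑ i, ∑ j, G w i j ^ 2) * (y ⬝ᵥ y)) ≤ τ⁻¹ * (τ ^ 2 * (y ⬝ᵥ y)) := by
    have := dotProduct_self_nonneg_real y
    gcongr
    exact hw.le
  have h4 : τ⁻¹ * (τ ^ 2 * (y ⬝ᵥ y)) = τ * (y ⬝ᵥ y) := by field_simp
  linarith

/-- A quadratic storage function certifying that the system `ẋ = A x + R ζ`, `y = C x` satisfies
`V̇ ≤ -a ‖y‖² + b ‖ζ‖²` with a margin that is strict in `(x, ζ)`. -/
def StrictGain (A : Matrix ι ι ℝ) (R : Matrix ι ρ ℝ) (C : Matrix o ι ℝ) (a b : ℝ) : Prop :=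
  ∃ P : Matrix ι ι ℝ, Pᵀ = P ∧ (∀ x, x ≠ 0 → 0 < x ⬝ᵥ P *ᵥ x) ∧ ∃ δ : ℝ, 0 < δ ∧
    ∀ (x : ι → ℝ) (ζ : ρ → ℝ), 2 * (x ⬝ᵥ P *ᵥ (A *ᵥ x + R *ᵥ ζ)) ≤
      -a * ((C *ᵥ x) ⬝ᵥ (C *ᵥ x)) + b * (ζ ⬝ᵥ ζ) - δ * (x ⬝ᵥ x + ζ ⬝ᵥ ζ)

/-- A quadratic Lyapunov function with a strict decrease rate. -/
def HasLyapunov (A : Matrix ι ι ℝ) : Prop :=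
  ∃ P : Matrix ι ι ℝ, Pᵀ = P ∧ (∀ x, x ≠ 0 → 0 < x ⬝ᵥ P *ᵥ x) ∧ ∃ δ : ℝ, 0 < δ ∧
    ∀ x : ι → ℝ, 2 * (x ⬝ᵥ P *ᵥ (A *ᵥ x)) ≤ -δ * (x ⬝ᵥ x)

lemma StrictGain.hasLyapunov {A : Matrix ι ι ℝ} {R : Matrix ι ρ ℝ} {C : Matrix o ι ℝ} {a b : ℝ}
    (ha : 0 ≤ a) (h : StrictGain A R C a b) : HasLyapunov A := by
  obtain ⟨P, hP, hpos, δ, hδ, h⟩ := h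
  refine ⟨P, hP, hpos, δ, hδ, fun x => ?_⟩
  have h1 := h x 0
  simp only [mulVec_zero, add_zero, dotProduct_zero, mul_zero] at h1
  have := mul_nonneg ha (dotProduct_self_nonneg_real (C *ᵥ x))
  linarith

lemma dotProduct_mulVec_nonneg_of_pos {P : Matrix ι ι ℝ}
    (hpos : ∀ x, x ≠ 0 → 0 < x ⬝ᵥ P *ᵥ x) {x : ι → ℝ} : 0 ≤ x ⬝ᵥ P *ᵥ x := by
  by_cases hx : x = 0
  · simp [hx]
  · exact (hpos x hx).le

lemma dotProduct_mulVec_comm_of_transpose_eq {P : Matrix ι ι ℝ} (hP : Pᵀ = P) (x y : ι → ℝ) :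
    x ⬝ᵥ P *ᵥ y = y ⬝ᵥ P *ᵥ x := by
  rw [dotProduct_mulVec, ← mulVec_transpose, hP, dotProduct_comm]

lemma mem_spectrum_complex_iff [DecidableEq ι] (A : Matrix ι ι ℂ) (μ : ℂ) :
    μ ∈ spectrum ℂ A ↔ ∃ v : ι → ℂ, v ≠ 0 ∧ A *ᵥ v = μ • v := by
  rw [spectrum.mem_iff, Matrix.isUnit_iff_isUnit_det, isUnit_iff_ne_zero, not_not,
    ← Matrix.exists_mulVec_eq_zero_iff]
  refine exists_congr fun v => and_congr_right fun _ => ?_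
  rw [sub_mulVec, Algebra.algebraMap_eq_smul_one, smul_mulVec, one_mulVec, sub_eq_zero, eq_comm]

lemma map_ofReal_mulVec_re {τ : Type*} (A : Matrix τ ι ℝ) (v : ι → ℂ)
    (i : τ) :
    ((A.map Complex.ofReal *ᵥ v) i).re = (A *ᵥ fun j => (v j).re) i := by
  simp [mulVec, dotProduct]

lemma map_ofReal_mulVec_im {τ : Type*} (A : Matrix τ ι ℝ) (v : ι → ℂ)
    (i : τ) :
    ((A.map Complex.ofReal *ᵥ v) i).im = (A *ᵥ fun j => (v j).im) i := by
  simp [mulVec, dotProduct]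

/-- For an eigenvector `a + i b`, adding the decrease inequalities at `a` and `b` cancels the terms
in `Im μ` and leaves `2 Re μ (aᵀ P a + bᵀ P b) ≤ -δ (‖a‖² + ‖b‖²) < 0`. -/
lemma HasLyapunov.isHurwitz [DecidableEq ι] {A : Matrix ι ι ℝ} (h : HasLyapunov A) :
    IsHurwitz A := by
  obtain ⟨P, hP, hpos, δ, hδ, h⟩ := h
  intro μ hμ
  obtain ⟨v, hv, hAv⟩ := (mem_spectrum_complex_iff _ _).1 hμ
  set a : ι → ℝ := fun j => (v j).re with ha
  set b : ι → ℝ := fun j => (v j).im with hb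
  have hAa : A *ᵥ a = μ.re • a - μ.im • b := by
    funext i
    rw [ha, ← map_ofReal_mulVec_re, hAv]; simp [hb]
  have hAb : A *ᵥ b = μ.re • b + μ.im • a := by
    funext i
    rw [hb, ← map_ofReal_mulVec_im, hAv]; simp [ha]
  have h1 := h a
  have h2 := h b
  rw [hAa] at h1
  rw [hAb] at h2
  simp only [mulVec_sub, mulVec_add, mulVec_smul, dotProduct_sub, dotProduct_add,
    dotProduct_smul, smul_eq_mul] at h1 h2
  rw [dotProduct_mulVec_comm_of_transpose_eq hP b a] at h2
  have hab : a ≠ 0 ∨ b ≠ 0 := by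
    by_contra! hc
    apply hv
    funext i
    exact Complex.ext (congrFun hc.1 i) (congrFun hc.2 i)
  have hnn := fun x => dotProduct_mulVec_nonneg_of_pos hpos (x := x)
  have hna := dotProduct_self_nonneg_real a
  have hnb := dotProduct_self_nonneg_real b
  by_contra! hre
  have k1 := mul_nonneg hre (hnn a)
  have k2 := mul_nonneg hre (hnn b)
  have k3 := mul_nonneg hδ.le hna
  have k4 := mul_nonneg hδ.le hnb
  rcases hab with hx | hx
  · have := mul_pos hδ (dotProduct_self_pos_real hx); linarith
  · have := mul_pos hδ (dotProduct_self_pos_real hx); linarith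

lemma StrictGain.hasExternalGain [DecidableEq ι] {A : Matrix ι ι ℝ} {R : Matrix ι ρ ℝ}
    {C : Matrix o ι ℝ} {γ : ℝ} (hγ : 0 < γ) (h : StrictGain A R C 1 γ) :
    HasExternalGain A R C γ := by
  refine ⟨(h.hasLyapunov zero_le_one).isHurwitz, ?_⟩
  obtain ⟨P, hP, hpos, δ, hδ, h⟩ := h
  refine ⟨P, Matrix.PosDef.of_dotProduct_mulVec_pos ?_ ?_, 1, γ, one_pos, hγ, div_one γ,
    fun x ζ => ?_⟩
  · rw [IsHermitian, conjTranspose_eq_transpose_of_trivial, hP]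
  · intro x hx
    simpa using hpos x hx
  · have h1 := h x ζ
    rw [dotProduct_mulVec_comm_of_transpose_eq hP (A *ᵥ x + R *ᵥ ζ) x]
    have := mul_nonneg hδ.le (add_nonneg (dotProduct_self_nonneg_real x)
      (dotProduct_self_nonneg_real ζ))
    linarith

/-- Pull the storage function back along `S`. The left inverse `S'` bounds `‖x‖` by a multiple of
`‖S x‖`, which keeps the pulled-back form definite and its margin positive. -/
lemma StrictGain.of_similar [DecidableEq ν] {A : Matrix ι ι ℝ} {R : Matrix ι ρ ℝ}
    {C : Matrix o ι ℝ} {a b : ℝ} (h : StrictGain A R C a b) {A' : Matrix ν ν ℝ}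
    {R' : Matrix ν ρ ℝ} {C' : Matrix o ν ℝ} (S : Matrix ι ν ℝ) (S' : Matrix ν ι ℝ)
    (hS : S' * S = 1) (hA : S * A' = A * S) (hR : S * R' = R) (hC : C' = C * S) :
    StrictGain A' R' C' a b := by
  obtain ⟨P, hP, hpos, δ, hδ, h⟩ := h
  have hinj : ∀ x : ν → ℝ, S' *ᵥ (S *ᵥ x) = x := fun x => by rw [mulVec_mulVec, hS, one_mulVec]
  have hform : ∀ x y : ν → ℝ, x ⬝ᵥ (Sᵀ * P * S) *ᵥ y = (S *ᵥ x) ⬝ᵥ P *ᵥ (S *ᵥ y) := fun x y => by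
    rw [← mulVec_mulVec, ← mulVec_mulVec, dotProduct_mulVec, vecMul_transpose]
  set c : ℝ := (∑ i, ∑ j, S' i j ^ 2) + 1 with hc
  have hc0 : 0 < c := by
    have h0 : 0 ≤ ∑ i, ∑ j, S' i j ^ 2 :=
      Finset.sum_nonneg fun i _ => Finset.sum_nonneg fun j _ => sq_nonneg _
    linarith
  refine ⟨Sᵀ * P * S, by simp [hP, Matrix.mul_assoc], fun x hx => ?_, δ / (c + 1),
    by positivity, fun x ζ => ?_⟩
  · rw [hform]
    refine hpos _ fun h0 => hx ?_
    rw [← hinj x, h0, mulVec_zero]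
  · have h1 := h (S *ᵥ x) ζ
    rw [hform, mulVec_add, mulVec_mulVec, mulVec_mulVec, hA, hR, ← mulVec_mulVec, hC,
      ← mulVec_mulVec]
    have h2 := mulVec_dotProduct_mulVec_le S' (S *ᵥ x)
    rw [hinj] at h2
    have h3 := dotProduct_self_nonneg_real (S *ᵥ x)
    have h4 := dotProduct_self_nonneg_real ζ
    have h5 : δ / (c + 1) * (x ⬝ᵥ x + ζ ⬝ᵥ ζ) ≤ δ * ((S *ᵥ x) ⬝ᵥ (S *ᵥ x) + ζ ⬝ᵥ ζ) := by
      rw [div_mul_eq_mul_div, div_le_iff₀ (by positivity), mul_assoc]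
      refine mul_le_mul_of_nonneg_left ?_ hδ.le
      nlinarith
    linarith

/-- The storage function at `w₀` still works nearby, since the changes in its derivative and in the
supply rate are quadratic forms with small coefficients, absorbed by the margin. -/
lemma StrictGain.eventually {W : Type*} [TopologicalSpace W] {w₀ : W} {A : W → Matrix ι ι ℝ}
    {R : W → Matrix ι ρ ℝ} {C : W → Matrix o ι ℝ} {a b : ℝ} (hA : ContinuousAt A w₀)
    (hR : ContinuousAt R w₀) (hC : ContinuousAt C w₀) (h : StrictGain (A w₀) (R w₀) (C w₀) a b) :
    ∀ᶠ w in 𝓝 w₀, StrictGain (A w) (R w) (C w) a b := by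
  obtain ⟨P, hP, hpos, δ, hδ, h⟩ := h
  -- The factor `a / 2` makes twice this form at `(x, x)` account for the change of `a ‖C x‖²`
  -- together with that of `2 xᵀ P A x`.
  have hG₁ : Filter.Tendsto (fun w => P * (A w - A w₀) +
      (a / 2) • ((C w)ᵀ * C w - (C w₀)ᵀ * C w₀)) (𝓝 w₀) (𝓝 0) := by
    have hc : ContinuousAt (fun w => P * (A w - A w₀) +
      (a / 2) • ((C w)ᵀ * C w - (C w₀)ᵀ * C w₀)) w₀ := by fun_prop
    simpa [ContinuousAt] using hc
  have hG₂ : Filter.Tendsto (fun w => P * (R w - R w₀)) (𝓝 w₀) (𝓝 0) := by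
    have hc : ContinuousAt (fun w => P * (R w - R w₀)) w₀ := by fun_prop
    simpa [ContinuousAt] using hc
  filter_upwards [eventually_two_mul_dotProduct_mulVec_le hG₁ (show 0 < δ / 8 by positivity),
    eventually_two_mul_dotProduct_mulVec_le hG₂ (show 0 < δ / 8 by positivity)] with w h₁ h₂
  refine ⟨P, hP, hpos, δ / 4, by positivity, fun x ζ => ?_⟩
  have e1 := h x ζ
  have e2 := h₁ x x
  have e3 := h₂ x ζ
  have hCC : ∀ D : Matrix o ι ℝ, x ⬝ᵥ (Dᵀ * D) *ᵥ x = (D *ᵥ x) ⬝ᵥ (D *ᵥ x) := fun D => by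
    rw [← mulVec_mulVec, dotProduct_mulVec, vecMul_transpose]
  rw [add_mulVec, smul_mulVec, sub_mulVec, dotProduct_add, dotProduct_smul, dotProduct_sub, hCC,
    hCC, ← mulVec_mulVec, sub_mulVec, mulVec_sub, dotProduct_sub, smul_eq_mul] at e2
  rw [← mulVec_mulVec, sub_mulVec, mulVec_sub, dotProduct_sub] at e3
  rw [mulVec_add, dotProduct_add] at e1 ⊢
  have := mul_nonneg hδ.le (dotProduct_self_nonneg_real x)
  have := mul_nonneg hδ.le (dotProduct_self_nonneg_real ζ)
  linarith

lemma StrictGain.of_blocks {A₁₁ : Matrix ι ι ℝ} {A₁₂ : Matrix ι ν ℝ} {A₂₁ : Matrix ν ι ℝ}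
    {A₂₂ : Matrix ν ν ℝ} {R₁ : Matrix ι ρ ℝ} {R₂ : Matrix ν ρ ℝ} {C : Matrix o ι ℝ} {a b : ℝ}
    (P₁ : Matrix ι ι ℝ) (hP₁ : P₁ᵀ = P₁) (hpos₁ : ∀ x, x ≠ 0 → 0 < x ⬝ᵥ P₁ *ᵥ x)
    (P₂ : Matrix ν ν ℝ) (hP₂ : P₂ᵀ = P₂) (hpos₂ : ∀ x, x ≠ 0 → 0 < x ⬝ᵥ P₂ *ᵥ x)
    {δ : ℝ} (hδ : 0 < δ)
    (h : ∀ x e ζ, 2 * (x ⬝ᵥ P₁ *ᵥ (A₁₁ *ᵥ x + A₁₂ *ᵥ e + R₁ *ᵥ ζ)) +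
      2 * (e ⬝ᵥ P₂ *ᵥ (A₂₁ *ᵥ x + A₂₂ *ᵥ e + R₂ *ᵥ ζ)) ≤
      -a * ((C *ᵥ x) ⬝ᵥ (C *ᵥ x)) + b * (ζ ⬝ᵥ ζ) - δ * (x ⬝ᵥ x + e ⬝ᵥ e + ζ ⬝ᵥ ζ)) :
    StrictGain (fromBlocks A₁₁ A₁₂ A₂₁ A₂₂) (fromRows R₁ R₂)
      (fromCols C (0 : Matrix o ν ℝ)) a b := by
  refine ⟨fromBlocks P₁ 0 0 P₂, by simp [fromBlocks_transpose, hP₁, hP₂], fun z hz => ?_, δ, hδ,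
    fun z ζ => ?_⟩
  · obtain ⟨x, e, rfl⟩ : ∃ x e, z = Sum.elim x e := ⟨_, _, (Sum.elim_comp_inl_inr z).symm⟩
    rw [fromBlocks_mulVec]
    simp only [Sum.elim_comp_inl, Sum.elim_comp_inr, zero_mulVec, add_zero, zero_add,
      sumElim_dotProduct_sumElim]
    by_cases hx : x = 0
    · have he : e ≠ 0 := by
        rintro rfl
        apply hz
        subst hx
        funext i
        cases i <;> rfl
      have := hpos₂ e he
      simpa [hx] using this
    · exact add_pos_of_pos_of_nonneg (hpos₁ x hx) (dotProduct_mulVec_nonneg_of_pos hpos₂)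
  · obtain ⟨x, e, rfl⟩ : ∃ x e, z = Sum.elim x e := ⟨_, _, (Sum.elim_comp_inl_inr z).symm⟩
    have h1 := h x e ζ
    have hz : fromBlocks A₁₁ A₁₂ A₂₁ A₂₂ *ᵥ Sum.elim x e + fromRows R₁ R₂ *ᵥ ζ =
        Sum.elim (A₁₁ *ᵥ x + A₁₂ *ᵥ e + R₁ *ᵥ ζ) (A₂₁ *ᵥ x + A₂₂ *ᵥ e + R₂ *ᵥ ζ) := by
      rw [fromBlocks_mulVec, fromRows_mulVec, ← Sum.elim_add_add]
      simp
    rw [hz, fromBlocks_mulVec, fromCols_mulVec]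
    simp only [Sum.elim_comp_inl, Sum.elim_comp_inr, zero_mulVec, add_zero, zero_add,
      sumElim_dotProduct_sumElim]
    linarith

/-- A Hurwitz subsystem that is not disturbed may drive a system without changing its gain. -/
lemma StrictGain.cascade_driven {A₁₁ : Matrix ι ι ℝ} {R₁ : Matrix ι ρ ℝ} {C : Matrix o ι ℝ}
    {a b : ℝ} (h : StrictGain A₁₁ R₁ C a b) (A₁₂ : Matrix ι ν ℝ) {A₂₂ : Matrix ν ν ℝ}
    (h₂ : HasLyapunov A₂₂) :
    StrictGain (fromBlocks A₁₁ A₁₂ 0 A₂₂) (fromRows R₁ (0 : Matrix ν ρ ℝ))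
      (fromCols C (0 : Matrix o ν ℝ)) a b := by
  obtain ⟨P, hP, hpos, δ, hδ, h⟩ := h
  obtain ⟨P₂, hP₂, hpos₂, δ₂, hδ₂, h₂⟩ := h₂
  obtain ⟨c, hc, hy⟩ := exists_two_mul_dotProduct_mulVec_le (P * A₁₂) (half_pos hδ)
  -- Large weight on the driving subsystem: its decrease `k δ₂ ‖e‖²` pays the cross term `c ‖e‖²`
  -- and leaves `δ / 2`.
  set k : ℝ := (c + δ / 2) / δ₂ with hk
  have hk0 : 0 < k := by positivity
  refine StrictGain.of_blocks P hP hpos (k • P₂) (by simp [hP₂]) (fun x hx => ?_)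
    (half_pos hδ) fun x e ζ => ?_
  · simpa [smul_mulVec] using mul_pos hk0 (hpos₂ x hx)
  · have e1 := h x ζ
    have e2 := mul_le_mul_of_nonneg_left (h₂ e) hk0.le
    have e3 := hy x e
    have e4 : k * (-δ₂ * (e ⬝ᵥ e)) = -(c + δ / 2) * (e ⬝ᵥ e) := by
      rw [hk]; field_simp
    rw [← mulVec_mulVec] at e3
    rw [mulVec_add, dotProduct_add] at e1
    simp only [zero_mulVec, zero_add, add_zero, smul_mulVec, dotProduct_smul, smul_eq_mul,
      mulVec_add, dotProduct_add]
    have := mul_nonneg hδ.le (dotProduct_self_nonneg_real ζ)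
    linarith

/-- A Hurwitz subsystem driven by a system and its disturbance does not change the gain. -/
lemma StrictGain.cascade_driving {A₁₁ : Matrix ι ι ℝ} {R₁ : Matrix ι ρ ℝ} {C : Matrix o ι ℝ}
    {a b : ℝ} (h : StrictGain A₁₁ R₁ C a b) (A₂₁ : Matrix ν ι ℝ) (R₂ : Matrix ν ρ ℝ)
    {A₂₂ : Matrix ν ν ℝ} (h₂ : HasLyapunov A₂₂) :
    StrictGain (fromBlocks A₁₁ 0 A₂₁ A₂₂) (fromRows R₁ R₂)
      (fromCols C (0 : Matrix o ν ℝ)) a b := by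
  obtain ⟨P, hP, hpos, δ, hδ, h⟩ := h
  obtain ⟨P₂, hP₂, hpos₂, δ₂, hδ₂, h₂⟩ := h₂
  obtain ⟨c, hc, hy⟩ := exists_two_mul_dotProduct_mulVec_le (P₂ * A₂₁)
    (show 0 < δ₂ / 4 by positivity)
  obtain ⟨c', hc', hy'⟩ := exists_two_mul_dotProduct_mulVec_le (P₂ * R₂)
    (show 0 < δ₂ / 4 by positivity)
  -- Small weight on the driven subsystem: what `x` and `ζ` inject into it costs at most half of
  -- their margin `δ`.
  set k : ℝ := δ / (2 * (c + c')) with hk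
  have hk0 : 0 < k := by positivity
  have hkc : k * (c + c') = δ / 2 := by rw [hk]; field_simp
  refine StrictGain.of_blocks P hP hpos (k • P₂) (by simp [hP₂]) (fun x hx => ?_)
    (show 0 < min (δ / 2) (k * δ₂ / 2) by positivity) fun x e ζ => ?_
  · simpa [smul_mulVec] using mul_pos hk0 (hpos₂ x hx)
  · have e1 := h x ζ
    have e2 := mul_le_mul_of_nonneg_left (h₂ e) hk0.le
    have e3 := mul_le_mul_of_nonneg_left (hy e x) hk0.le
    have e4 := mul_le_mul_of_nonneg_left (hy' e ζ) hk0.le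
    rw [← mulVec_mulVec] at e3 e4
    rw [mulVec_add, dotProduct_add] at e1
    simp only [zero_mulVec, add_zero, smul_mulVec, dotProduct_smul, smul_eq_mul,
      mulVec_add, dotProduct_add]
    have nx := dotProduct_self_nonneg_real x
    have ne := dotProduct_self_nonneg_real e
    have nζ := dotProduct_self_nonneg_real ζ
    have f1 : k * c * (x ⬝ᵥ x) ≤ δ / 2 * (x ⬝ᵥ x) :=
      mul_le_mul_of_nonneg_right (by nlinarith) nx
    have f2 : k * c' * (ζ ⬝ᵥ ζ) ≤ δ / 2 * (ζ ⬝ᵥ ζ) :=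
      mul_le_mul_of_nonneg_right (by nlinarith) nζ
    have g1 := mul_le_mul_of_nonneg_right (min_le_left (δ / 2) (k * δ₂ / 2)) nx
    have g2 := mul_le_mul_of_nonneg_right (min_le_right (δ / 2) (k * δ₂ / 2)) ne
    have g3 := mul_le_mul_of_nonneg_right (min_le_left (δ / 2) (k * δ₂ / 2)) nζ
    linarith

/-- One step of high-gain backstepping. -/
lemma StrictGain.backstep [DecidableEq ν] {A₁₁ : Matrix ι ι ℝ} {R₁ : Matrix ι ρ ℝ}
    {C : Matrix o ι ℝ} {a b : ℝ} (h : StrictGain A₁₁ R₁ C a b) (A₁₂ : Matrix ι ν ℝ)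
    (R₂ : Matrix ν ρ ℝ) :
    ∃ k : ℝ, StrictGain (fromBlocks A₁₁ A₁₂ 0 (-k • (1 : Matrix ν ν ℝ))) (fromRows R₁ R₂)
      (fromCols C (0 : Matrix o ν ℝ)) a b := by
  obtain ⟨P, hP, hpos, δ, hδ, h⟩ := h
  obtain ⟨c, hc, hy⟩ := exists_two_mul_dotProduct_mulVec_le (P * A₁₂) (half_pos hδ)
  obtain ⟨c', hc', hy'⟩ := exists_two_mul_dotProduct_mulVec_le' R₂ (half_pos hδ)
  -- With storage `‖e‖²`, the damping contributes `-2 k ‖e‖²`: `c` pays for the coupling, `c'` for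
  -- the disturbance, `δ / 2` is the new margin.
  refine ⟨(c + c' + δ / 2) / 2, StrictGain.of_blocks P hP hpos 1 (by simp) (fun x hx => ?_)
    (half_pos hδ) fun x e ζ => ?_⟩
  · simpa using dotProduct_self_pos_real hx
  · have e1 := h x ζ
    have e3 := hy x e
    have e4 := hy' e ζ
    rw [← mulVec_mulVec] at e3
    rw [mulVec_add, dotProduct_add] at e1
    simp only [zero_mulVec, zero_add, smul_mulVec, dotProduct_smul, smul_eq_mul, one_mulVec,
      mulVec_add, dotProduct_add]
    linarith

/-- Strong enough damping dominates both the disturbance cross term and the output energy; half of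
`b` is kept as the margin in `ζ`. -/
lemma strictGain_neg_smul_one [DecidableEq ι] (R : Matrix ι ρ ℝ) (C : Matrix o ι ℝ) {a b : ℝ}
    (hb : 0 < b) (ha : 0 ≤ a) : ∃ k : ℝ, StrictGain (-k • (1 : Matrix ι ι ℝ)) R C a b := by
  obtain ⟨c, hc, hy⟩ := exists_two_mul_dotProduct_mulVec_le' R (half_pos hb)
  set s : ℝ := ∑ i, ∑ j, C i j ^ 2 with hs
  refine ⟨(c + a * s + b / 2) / 2, 1, by simp, fun x hx => ?_, b / 2, by positivity,
    fun x ζ => ?_⟩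
  · simpa using dotProduct_self_pos_real hx
  · have e1 := hy x ζ
    have e2 := mul_le_mul_of_nonneg_left (mulVec_dotProduct_mulVec_le C x) ha
    simp only [smul_mulVec, dotProduct_smul, smul_eq_mul, one_mulVec, dotProduct_add]
    linarith

end QuadraticEstimates

/-! ### Lyapunov inequality by convex separation; the Hautus test -/

section LyapunovDuality

lemma exists_eigenvector_mem_of_invariant {V : Type*} [AddCommGroup V] [Module ℂ V]
    [FiniteDimensional ℂ V] (f : Module.End ℂ V) (W : Submodule ℂ V) (hW : ∀ x ∈ W, f x ∈ W)
    (hne : W ≠ ⊥) : ∃ μ : ℂ, ∃ v ∈ W, v ≠ 0 ∧ f v = μ • v := by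
  have : Nontrivial W := Submodule.nontrivial_iff_ne_bot.2 hne
  obtain ⟨μ, hμ⟩ := Module.End.exists_eigenvalue (f.restrict hW)
  obtain ⟨v, hv⟩ := hμ.exists_hasEigenvector
  refine ⟨μ, v, v.2, fun h0 => hv.2 (Subtype.ext h0), ?_⟩
  exact congrArg Subtype.val hv.apply_eq_smul

variable {ι o : Type*} [Fintype ι] [Fintype o]

lemma nonneg_of_forall_pos_add {a b : ℝ} (h : ∀ ε : ℝ, 0 < ε → 0 < a + ε * b) : 0 ≤ a := by
  by_contra! ha
  have h1 := h (-a / (|b| + 1)) (div_pos (by linarith) (by positivity))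
  have h2 : -a / (|b| + 1) * b ≤ -a / (|b| + 1) * |b| :=
    mul_le_mul_of_nonneg_left (le_abs_self b) (div_pos (by linarith) (by positivity)).le
  have h3 : -a / (|b| + 1) * |b| < -a := by
    rw [div_mul_eq_mul_div, div_lt_iff₀ (by positivity)]
    nlinarith
  linarith

lemma mul_eq_of_ker_le [DecidableEq ι] {Z Y : Matrix ι ι ℝ} (h : ∀ x, Z *ᵥ x = 0 → Y *ᵥ x = 0) :
    ∃ G : Matrix ι ι ℝ, Y = G * Z := by
  obtain ⟨g, hg⟩ : ∃ g, g ∘ₗ Z.mulVecLin = Y.mulVecLin := by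
    let f := Z.mulVecLin
    obtain ⟨s, hs⟩ := f.rangeRestrict.exists_rightInverse_of_surjective f.range_rangeRestrict
    obtain ⟨g, hg⟩ := (Y.mulVecLin ∘ₗ s).exists_extend
    refine ⟨g, LinearMap.ext fun x => ?_⟩
    have h1 : g (f x) = Y.mulVecLin (s (f.rangeRestrict x)) :=
      LinearMap.congr_fun hg (f.rangeRestrict x)
    have h2 : f (s (f.rangeRestrict x)) = f x :=
      congrArg Subtype.val (LinearMap.congr_fun hs (f.rangeRestrict x))
    have h3 := h (s (f.rangeRestrict x) - x)
      (by rw [mulVec_sub]; exact sub_eq_zero.2 h2)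
    rw [mulVec_sub, sub_eq_zero] at h3
    rw [LinearMap.comp_apply]
    exact h1.trans h3
  refine ⟨LinearMap.toMatrix' g, ?_⟩
  have := congrArg LinearMap.toMatrix' hg
  rw [LinearMap.toMatrix'_comp, ← toLin'_apply', ← toLin'_apply', LinearMap.toMatrix'_toLin',
    LinearMap.toMatrix'_toLin'] at this
  exact this.symm

lemma map_ofReal_mulVec_mul {κ τ : Type*} [Fintype κ] (A : Matrix τ ι ℝ)
    (B : Matrix ι κ ℝ) (v : κ → ℂ) : A.map Complex.ofReal *ᵥ (B.map Complex.ofReal *ᵥ v) =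
      (A * B).map Complex.ofReal *ᵥ v := by
  rw [mulVec_mulVec]
  congr 1
  exact (Matrix.map_mul (f := Complex.ofRealHom)).symm

/-- If `S = A Z + Z Aᵀ` and `Z ≠ 0` are positive semidefinite then `A` has an eigenvector in the
range of `Z` for an eigenvalue in the closed right half-plane. -/
lemma exists_unstable_eigenvector [DecidableEq ι] {A Z : Matrix ι ι ℝ} (hZ : Z.PosSemidef)
    (hZ0 : Z ≠ 0) (hS : ∀ x, 0 ≤ x ⬝ᵥ Z *ᵥ (Aᵀ *ᵥ x)) :
    ∃ μ : ℂ, 0 ≤ μ.re ∧ ∃ y : ι → ℂ, Z.map Complex.ofReal *ᵥ y ≠ 0 ∧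
      A.map Complex.ofReal *ᵥ (Z.map Complex.ofReal *ᵥ y) =
        μ • (Z.map Complex.ofReal *ᵥ y) := by
  have hZt : Zᵀ = Z := by
    rw [← conjTranspose_eq_transpose_of_trivial]; exact hZ.isHermitian
  have hzero : ∀ x, x ⬝ᵥ Z *ᵥ x = 0 → Z *ᵥ x = 0 := fun x hx =>
    (hZ.dotProduct_mulVec_zero_iff x).1 (by simpa using hx)
  have hnn : ∀ x, 0 ≤ x ⬝ᵥ Z *ᵥ x := fun x => by simpa using hZ.dotProduct_mulVec_nonneg x
  have hAZ : ∀ x y, x ⬝ᵥ A *ᵥ (Z *ᵥ y) = y ⬝ᵥ Z *ᵥ (Aᵀ *ᵥ x) := fun x y => by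
    rw [dotProduct_mulVec, ← mulVec_transpose, dotProduct_mulVec_comm_of_transpose_eq hZt]
  have hSpsd : (A * Z + Z * Aᵀ).PosSemidef := by
    refine Matrix.PosSemidef.of_dotProduct_mulVec_nonneg ?_ fun x => ?_
    · rw [IsHermitian, conjTranspose_eq_transpose_of_trivial]
      simp [hZt, add_comm]
    · have := hS x
      simp only [star_trivial, add_mulVec, ← mulVec_mulVec, dotProduct_add]
      rw [hAZ]
      linarith
  -- On the kernel of `Z` the form of the semidefinite matrix `A Z + Z Aᵀ` vanishes, hence so does
  -- the matrix itself. Factoring `Z Aᵀ` through `Z` and transposing shows that `A` preserves the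
  -- range of `Z`, so it has an eigenvector there.
  have hker : ∀ x, Z *ᵥ x = 0 → (Z * Aᵀ) *ᵥ x = 0 := fun x hx => by
    have h1 : (A * Z + Z * Aᵀ) *ᵥ x = 0 := by
      refine (hSpsd.dotProduct_mulVec_zero_iff x).1 ?_
      simp only [star_trivial, add_mulVec, ← mulVec_mulVec, dotProduct_add]
      rw [← hAZ, hx]
      simp
    simpa [add_mulVec, ← mulVec_mulVec, hx] using h1
  obtain ⟨G, hG⟩ := mul_eq_of_ker_le hker
  have hG' : A * Z = Z * Gᵀ := by
    have := congrArg transpose hG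
    simpa [hZt] using this
  obtain ⟨μ, v, ⟨y, rfl⟩, hv0, hv⟩ := exists_eigenvector_mem_of_invariant
    (A.map Complex.ofReal).mulVecLin (LinearMap.range (Z.map Complex.ofReal).mulVecLin)
    (by
      rintro _ ⟨y, rfl⟩
      refine ⟨Gᵀ.map Complex.ofReal *ᵥ y, ?_⟩
      simp only [mulVecLin_apply]
      rw [map_ofReal_mulVec_mul, map_ofReal_mulVec_mul, hG'])
    (by
      rw [ne_eq, LinearMap.range_eq_bot]
      intro h0
      apply hZ0
      ext i j
      have := congrFun (LinearMap.congr_fun h0 (Pi.single j 1)) i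
      simpa using this)
  simp only [mulVecLin_apply] at hv hv0
  refine ⟨μ, ?_, y, hv0, hv⟩
  set a : ι → ℝ := fun j => (y j).re with ha
  set b : ι → ℝ := fun j => (y j).im with hb
  have hpr : (fun j => ((Z.map Complex.ofReal *ᵥ y) j).re) = Z *ᵥ a :=
    funext fun i => map_ofReal_mulVec_re Z y i
  have hpi : (fun j => ((Z.map Complex.ofReal *ᵥ y) j).im) = Z *ᵥ b :=
    funext fun i => map_ofReal_mulVec_im Z y i
  have hAa : A *ᵥ (Z *ᵥ a) = μ.re • (Z *ᵥ a) - μ.im • (Z *ᵥ b) := by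
    rw [← hpr, ← hpi]
    funext i
    rw [← map_ofReal_mulVec_re, hv]; simp
  have hAb : A *ᵥ (Z *ᵥ b) = μ.re • (Z *ᵥ b) + μ.im • (Z *ᵥ a) := by
    rw [← hpr, ← hpi]
    funext i
    rw [← map_ofReal_mulVec_im, hv]; simp
  have h1 := hS a
  have h2 := hS b
  rw [← hAZ, hAa] at h1
  rw [← hAZ, hAb] at h2
  simp only [dotProduct_sub, dotProduct_add, dotProduct_smul, smul_eq_mul] at h1 h2
  rw [dotProduct_mulVec_comm_of_transpose_eq hZt b a] at h2
  -- The two inequalities add up to `0 ≤ Re μ (aᵀ Z a + bᵀ Z b)`; a negative real part would force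
  -- `Z a = Z b = 0`, making the eigenvector zero.
  by_contra! hre
  have ea : a ⬝ᵥ Z *ᵥ a = 0 := by nlinarith [hnn a, hnn b]
  have eb : b ⬝ᵥ Z *ᵥ b = 0 := by nlinarith [hnn a, hnn b]
  apply hv0
  funext i
  refine Complex.ext ?_ ?_
  · rw [congrFun hpr i, hzero a ea]; rfl
  · rw [congrFun hpi i, hzero b eb]; rfl

/-- A linear functional that is nonnegative on matrices with nonnegative quadratic form is
`Q ↦ tr (Q Zᵀ)` with `Z` positive semidefinite. -/
lemma exists_posSemidef_of_functional [DecidableEq ι] (φ : Matrix ι ι ℝ →ₗ[ℝ] ℝ)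
    (hφ : ∀ Q, (∀ x, 0 ≤ x ⬝ᵥ Q *ᵥ x) → 0 ≤ φ Q) :
    ∃ Z : Matrix ι ι ℝ, Z.PosSemidef ∧ (∀ x y, φ (vecMulVec x y) = x ⬝ᵥ Z *ᵥ y) ∧
      (Z = 0 → φ = 0) := by
  have hsum : ∀ Q, φ Q = ∑ i, ∑ j, Q i j * φ (single i j 1) := fun Q => by
    conv_lhs => rw [matrix_eq_sum_single Q]
    simp only [map_sum]
    refine Finset.sum_congr rfl fun i _ => Finset.sum_congr rfl fun j _ => ?_
    rw [← smul_eq_mul, ← map_smul, smul_single, smul_eq_mul, mul_one]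
  have hvec : ∀ x y, φ (vecMulVec x y) = x ⬝ᵥ (of fun i j => φ (single i j 1)) *ᵥ y :=
    fun x y => by
      rw [hsum]
      simp only [dotProduct, mulVec, Finset.mul_sum, vecMulVec_apply, of_apply]
      refine Finset.sum_congr rfl fun i _ => Finset.sum_congr rfl fun j _ => ?_
      ring
  refine ⟨of fun i j => φ (single i j 1),
    Matrix.PosSemidef.of_dotProduct_mulVec_nonneg ?_ fun x => ?_, hvec, fun h0 => ?_⟩
  · have hq : ∀ (i j : ι) (x : ι → ℝ), x ⬝ᵥ (single i j (1 : ℝ)) *ᵥ x = x i * x j :=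
      fun i j x => by
        rw [single_eq_single_vecMulVec_single, vecMulVec_mulVec, dotProduct_smul]
        simp [mul_comm]
    -- Skew matrices have zero quadratic form, so the positivity of `φ` applies to them with both
    -- signs; this is where the symmetry of `Z` comes from.
    have hle : ∀ i j, φ (single i j 1) ≤ φ (single j i 1) := fun i j => by
      have := hφ (single j i 1 - single i j 1) fun x => by
        rw [sub_mulVec, dotProduct_sub, hq, hq]; linarith [mul_comm (x i) (x j)]
      rw [map_sub] at this
      linarith
    ext i j
    simpa using le_antisymm (hle j i) (hle i j)
  · rw [star_trivial, ← hvec]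
    refine hφ _ fun y => ?_
    rw [vecMulVec_mulVec, dotProduct_smul]
    rw [MulOpposite.smul_eq_mul_unop, MulOpposite.unop_op]
    rw [dotProduct_comm y x]
    exact mul_self_nonneg _
  · refine LinearMap.ext fun Q => ?_
    rw [hsum]
    refine Finset.sum_eq_zero fun i _ => Finset.sum_eq_zero fun j _ => ?_
    have : φ (single i j 1) = 0 := congrFun (congrFun h0 i) j
    rw [this, mul_zero]


/-- Coercive quadratic forms make up an open set. -/
lemma isOpen_coercive :
    IsOpen {Q : Matrix ι ι ℝ | ∃ δ : ℝ, 0 < δ ∧ ∀ x : ι → ℝ, δ * (x ⬝ᵥ x) ≤ x ⬝ᵥ Q *ᵥ x} := by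
  rw [isOpen_iff_mem_nhds]
  rintro Q ⟨δ, hδ, hQ⟩
  have ht : Filter.Tendsto (fun Q' => Q - Q') (𝓝 Q) (𝓝 0) := by
    have hc : ContinuousAt (fun Q' => Q - Q') Q := by fun_prop
    simpa [ContinuousAt] using hc
  filter_upwards [eventually_two_mul_dotProduct_mulVec_le ht (half_pos hδ)] with Q' hQ'
  refine ⟨δ / 2, half_pos hδ, fun x => ?_⟩
  have h1 := hQ' x x
  have h2 := hQ x
  rw [sub_mulVec, dotProduct_sub] at h1
  linarith

lemma convex_coercive :
    Convex ℝ {Q : Matrix ι ι ℝ | ∃ δ : ℝ, 0 < δ ∧ ∀ x : ι → ℝ, δ * (x ⬝ᵥ x) ≤ x ⬝ᵥ Q *ᵥ x} := by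
  rintro Q ⟨δ, hδ, hQ⟩ Q' ⟨δ', hδ', hQ'⟩ s t hs ht hst
  refine ⟨min δ δ', lt_min hδ hδ', fun x => ?_⟩
  have hx := dotProduct_self_nonneg_real x
  rw [add_mulVec, smul_mulVec, smul_mulVec, dotProduct_add, dotProduct_smul, dotProduct_smul,
    smul_eq_mul, smul_eq_mul]
  have h1 := mul_le_mul_of_nonneg_left
    ((mul_le_mul_of_nonneg_right (min_le_left δ δ') hx).trans (hQ x)) hs
  have h2 := mul_le_mul_of_nonneg_left
    ((mul_le_mul_of_nonneg_right (min_le_right δ δ') hx).trans (hQ' x)) ht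
  calc min δ δ' * (x ⬝ᵥ x) = s * (min δ δ' * (x ⬝ᵥ x)) + t * (min δ δ' * (x ⬝ᵥ x)) := by
        rw [← add_mul, hst, one_mul]
    _ ≤ _ := add_le_add h1 h2

/-- The linear matrix inequality map `(P, τ) ↦ (P + Pᵀ, τ Cᵀ C - Aᵀ (P + Pᵀ) - (P + Pᵀ) A)`. -/
def lmiMap (A : Matrix ι ι ℝ) (C : Matrix o ι ℝ) :
    Matrix ι ι ℝ × ℝ →ₗ[ℝ] Matrix ι ι ℝ × Matrix ι ι ℝ where
  toFun p := (p.1 + p.1ᵀ, p.2 • (Cᵀ * C) - (Aᵀ * (p.1 + p.1ᵀ) + (p.1 + p.1ᵀ) * A))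
  map_add' p q := by
    refine Prod.ext ?_ ?_
    · simp only [Prod.fst_add, transpose_add]; abel
    · simp only [Prod.fst_add, Prod.snd_add, transpose_add, Matrix.mul_add, Matrix.add_mul,
        add_smul]
      abel
  map_smul' c p := by
    refine Prod.ext ?_ ?_ <;>
    simp [mul_smul, smul_sub, smul_add, Matrix.mul_add, Matrix.add_mul]

/-- Separation of an open convex subset of a product from the range of a linear map. -/
lemma exists_functionals_of_disjoint_range {E F : Type*} [AddCommGroup E] [Module ℝ E]
    [TopologicalSpace E] [IsTopologicalAddGroup E] [ContinuousSMul ℝ E] [AddCommGroup F]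
    [Module ℝ F] (Λ : F →ₗ[ℝ] E × E) {s : Set (E × E)} (hs : Convex ℝ s) (hso : IsOpen s)
    (hdisj : Disjoint s (LinearMap.range Λ : Set (E × E))) :
    ∃ ψ φ : E →ₗ[ℝ] ℝ, (∀ P Q, (P, Q) ∈ s → 0 < ψ P + φ Q) ∧
      ∀ p, ψ (Λ p).1 + φ (Λ p).2 = 0 := by
  obtain ⟨f, u, hfs, hft⟩ := geometric_hahn_banach_open hs hso (LinearMap.range Λ).convex hdisj
  have hf0 : ∀ p, f (Λ p) = 0 := fun p => by
    by_contra hne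
    -- A functional bounded below by `u` on a subspace vanishes there: otherwise rescaling gives it
    -- the value `u - 1`.
    have := hft (Λ (((u - 1) / f (Λ p)) • p)) ⟨_, rfl⟩
    rw [map_smul, map_smul, smul_eq_mul, div_mul_cancel₀ _ hne] at this
    linarith
  have hu : u ≤ 0 := by simpa using hft 0 (Submodule.zero_mem _)
  have hf : ∀ P Q, f (P, Q) = f (P, 0) + f (0, Q) := fun P Q => by
    rw [← map_add, Prod.mk_add_mk, add_zero, zero_add]
  refine ⟨-(f.toLinearMap ∘ₗ LinearMap.inl ℝ E E), -(f.toLinearMap ∘ₗ LinearMap.inr ℝ E E),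
    fun P Q hPQ => ?_, fun p => ?_⟩
  · have := hfs (P, Q) hPQ
    rw [hf] at this
    simp only [LinearMap.neg_apply, LinearMap.comp_apply, LinearMap.inl_apply,
      LinearMap.inr_apply, ContinuousLinearMap.coe_coe]
    linarith
  · have := hf0 p
    rw [← Prod.mk.eta (p := Λ p), hf] at this
    simp only [LinearMap.neg_apply, LinearMap.comp_apply, LinearMap.inl_apply,
      LinearMap.inr_apply, ContinuousLinearMap.coe_coe]
    linarith

/-- Infeasibility of the linear matrix inequality is witnessed by a pair of positive functionals. -/
lemma exists_functionals_of_not_lmi [DecidableEq ι] (A : Matrix ι ι ℝ) (C : Matrix o ι ℝ)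
    (hno : ¬ ∃ P : Matrix ι ι ℝ, Pᵀ = P ∧ (∀ x, x ≠ 0 → 0 < x ⬝ᵥ P *ᵥ x) ∧ ∃ τ δ : ℝ, 0 < δ ∧
      ∀ x : ι → ℝ, 2 * (x ⬝ᵥ P *ᵥ (A *ᵥ x)) ≤
        τ * ((C *ᵥ x) ⬝ᵥ (C *ᵥ x)) - δ * (x ⬝ᵥ x)) :
    ∃ ψ φ : Matrix ι ι ℝ →ₗ[ℝ] ℝ,
      (∀ P Q : Matrix ι ι ℝ, (∃ δ : ℝ, 0 < δ ∧ ∀ x : ι → ℝ, δ * (x ⬝ᵥ x) ≤ x ⬝ᵥ P *ᵥ x) →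
        (∃ δ : ℝ, 0 < δ ∧ ∀ x : ι → ℝ, δ * (x ⬝ᵥ x) ≤ x ⬝ᵥ Q *ᵥ x) → 0 < ψ P + φ Q) ∧
      φ (Cᵀ * C) = 0 ∧ ∀ P, ψ (P + Pᵀ) = φ (Aᵀ * (P + Pᵀ) + (P + Pᵀ) * A) := by
  let s := {Q : Matrix ι ι ℝ | ∃ δ : ℝ, 0 < δ ∧ ∀ x : ι → ℝ, δ * (x ⬝ᵥ x) ≤ x ⬝ᵥ Q *ᵥ x}
  have hdisj : Disjoint (s ×ˢ s) (LinearMap.range (lmiMap A C) : Set _) := by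
    rw [Set.disjoint_left]
    rintro _ ⟨⟨δ₁, hδ₁, h₁⟩, δ₂, hδ₂, h₂⟩ ⟨⟨P, τ⟩, rfl⟩
    -- Symmetrising lets `P` range over all matrices, and a coercive point of the range is exactly a
    -- solution of the inequality.
    refine hno ⟨P + Pᵀ, by simp [add_comm], fun x hx => ?_, τ, δ₂, hδ₂, fun x => ?_⟩
    · exact (mul_pos hδ₁ (dotProduct_self_pos_real hx)).trans_le (h₁ x)
    · have e := h₂ x
      have e1 : x ⬝ᵥ (Cᵀ * C) *ᵥ x = (C *ᵥ x) ⬝ᵥ (C *ᵥ x) := by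
        rw [← mulVec_mulVec, dotProduct_mulVec, vecMul_transpose]
      have e2 : x ⬝ᵥ (Aᵀ * (P + Pᵀ)) *ᵥ x = x ⬝ᵥ (P + Pᵀ) *ᵥ (A *ᵥ x) := by
        rw [← mulVec_mulVec, dotProduct_mulVec, vecMul_transpose,
          dotProduct_mulVec_comm_of_transpose_eq (by simp [add_comm])]
      simp only [lmiMap, LinearMap.coe_mk, AddHom.coe_mk] at e
      rw [sub_mulVec, add_mulVec, smul_mulVec, dotProduct_sub, dotProduct_add, dotProduct_smul,
        smul_eq_mul, e1, e2, ← mulVec_mulVec] at e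
      linarith
  obtain ⟨ψ, φ, hpos, h0⟩ := exists_functionals_of_disjoint_range (lmiMap A C)
    (convex_coercive.prod convex_coercive) (isOpen_coercive.prod isOpen_coercive) hdisj
  refine ⟨ψ, φ, fun P Q hP hQ => hpos P Q ⟨hP, hQ⟩, ?_, fun P => ?_⟩
  · have := h0 (0, 1)
    simpa [lmiMap] using this
  · have := h0 (P, 0)
    simp only [lmiMap, LinearMap.coe_mk, AddHom.coe_mk] at this
    rw [zero_smul, zero_sub, φ.map_neg] at this
    linarith

/-- If no eigenvector of `A` for an eigenvalue in the closed right half-plane is in the kernel of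
`C`, then the strict linear matrix inequality `Aᵀ P + P A < τ Cᵀ C` has a solution `P > 0`. -/
theorem exists_posDef_lmi [DecidableEq ι] (A : Matrix ι ι ℝ) (C : Matrix o ι ℝ)
    (h : ∀ μ : ℂ, 0 ≤ μ.re → ∀ v : ι → ℂ, A.map Complex.ofReal *ᵥ v = μ • v →
      C.map Complex.ofReal *ᵥ v = 0 → v = 0) :
    ∃ P : Matrix ι ι ℝ, Pᵀ = P ∧ (∀ x, x ≠ 0 → 0 < x ⬝ᵥ P *ᵥ x) ∧ ∃ τ δ : ℝ, 0 < δ ∧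
      ∀ x : ι → ℝ, 2 * (x ⬝ᵥ P *ᵥ (A *ᵥ x)) ≤
        τ * ((C *ᵥ x) ⬝ᵥ (C *ᵥ x)) - δ * (x ⬝ᵥ x) := by
  by_contra hno
  obtain ⟨ψ, φ, hpos, hC, hA⟩ := exists_functionals_of_not_lmi A C hno
  -- Adding `ε • 1` makes a nonnegative form coercive; letting `ε → 0` gives nonnegativity of `ψ`
  -- and `φ` separately.
  have hε : ∀ Q : Matrix ι ι ℝ, (∀ x, 0 ≤ x ⬝ᵥ Q *ᵥ x) → ∀ ε : ℝ, 0 < ε →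
      ∃ δ : ℝ, 0 < δ ∧ ∀ x : ι → ℝ,
        δ * (x ⬝ᵥ x) ≤ x ⬝ᵥ (Q + ε • (1 : Matrix ι ι ℝ)) *ᵥ x := fun Q hQ ε he => by
    refine ⟨ε, he, fun x => ?_⟩
    rw [add_mulVec, dotProduct_add, smul_mulVec, one_mulVec, dotProduct_smul, smul_eq_mul]
    linarith [hQ x]
  have hε0 : ∀ ε : ℝ, 0 < ε → ∃ δ : ℝ, 0 < δ ∧ ∀ x : ι → ℝ,
      δ * (x ⬝ᵥ x) ≤ x ⬝ᵥ (ε • (1 : Matrix ι ι ℝ)) *ᵥ x := fun ε he => by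
    simpa using hε 0 (by simp) ε he
  have hψ : ∀ Q, (∀ x, 0 ≤ x ⬝ᵥ Q *ᵥ x) → 0 ≤ ψ Q := fun Q hQ => by
    refine nonneg_of_forall_pos_add (b := ψ 1 + φ 1) fun ε he => ?_
    have := hpos _ _ (hε Q hQ ε he) (hε0 ε he)
    simp only [map_add, map_smul, smul_eq_mul] at this
    linarith
  have hφ : ∀ Q, (∀ x, 0 ≤ x ⬝ᵥ Q *ᵥ x) → 0 ≤ φ Q := fun Q hQ => by
    refine nonneg_of_forall_pos_add (b := ψ 1 + φ 1) fun ε he => ?_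
    have := hpos _ _ (hε0 ε he) (hε Q hQ ε he)
    simp only [map_add, map_smul, smul_eq_mul] at this
    linarith
  obtain ⟨Z, hZ, hvec, hZ0⟩ := exists_posSemidef_of_functional φ hφ
  -- If `φ` vanished, the adjoint relation would give `ψ (1 + 1ᵀ) = 0`, against strict positivity at
  -- `(1 + 1ᵀ, 1)`.
  have hφ0 : φ ≠ 0 := fun h0 => by
    have h1 := hpos (1 + 1ᵀ) 1 (by
      rw [transpose_one, ← two_smul ℝ (1 : Matrix ι ι ℝ)]; exact hε0 2 two_pos)
      (by simpa using hε0 1 one_pos)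
    rw [hA, h0] at h1
    simp at h1
  have hCZ : ∀ k, Z *ᵥ C k = 0 := fun k => by
    have hsum : Cᵀ * C = ∑ k, vecMulVec (C k) (C k) := by
      ext i j
      simp [Matrix.mul_apply, Matrix.sum_apply, vecMulVec_apply]
    rw [hsum, map_sum] at hC
    simp only [hvec] at hC
    have hnn : ∀ k ∈ Finset.univ, 0 ≤ C k ⬝ᵥ Z *ᵥ C k := fun k _ => by
      simpa using hZ.dotProduct_mulVec_nonneg (C k)
    have := (Finset.sum_eq_zero_iff_of_nonneg hnn).1 hC k (Finset.mem_univ k)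
    exact (hZ.dotProduct_mulVec_zero_iff _).1 (by simpa using this)
  have hZt : Zᵀ = Z := by
    rw [← conjTranspose_eq_transpose_of_trivial]; exact hZ.isHermitian
  have hCZ' : C * Z = 0 := by
    ext k j
    have := congrFun (hCZ k) j
    rw [← hZt, mulVec_transpose] at this
    exact this
  -- Testing the adjoint relation on `P = x xᵀ` gives `4 xᵀ Z Aᵀ x = ψ (2 x xᵀ) ≥ 0`. The resulting
  -- unstable eigenvector lies in the range of `Z`, which `C` annihilates, contrary to the
  -- hypothesis.
  obtain ⟨μ, hμ, y, hy, hAy⟩ := exists_unstable_eigenvector (A := A) hZ (mt hZ0 hφ0) fun x => by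
    have h1 := hA (vecMulVec x x)
    have h2 : 0 ≤ ψ (vecMulVec x x + (vecMulVec x x)ᵀ) := by
      refine hψ _ fun y => ?_
      rw [transpose_vecMulVec, add_mulVec, vecMulVec_mulVec, dotProduct_add, dotProduct_smul,
        MulOpposite.smul_eq_mul_unop, MulOpposite.unop_op, dotProduct_comm y x]
      nlinarith [mul_self_nonneg (x ⬝ᵥ y)]
    have h3 : Aᵀ * (vecMulVec x x + (vecMulVec x x)ᵀ) + (vecMulVec x x + (vecMulVec x x)ᵀ) * A =
        (2 : ℝ) • (vecMulVec (Aᵀ *ᵥ x) x + vecMulVec x (Aᵀ *ᵥ x)) := by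
      rw [transpose_vecMulVec, ← two_smul ℝ, Matrix.mul_smul, Matrix.smul_mul, mul_vecMulVec,
        vecMulVec_mul, smul_add, mulVec_transpose]
    rw [h3, φ.map_smul, φ.map_add, hvec, hvec, smul_eq_mul,
      dotProduct_mulVec_comm_of_transpose_eq hZt (Aᵀ *ᵥ x) x] at h1
    linarith
  refine hy (h μ hμ _ hAy ?_)
  rw [map_ofReal_mulVec_mul, hCZ']
  simp

/-- Lyapunov's theorem. -/
theorem IsHurwitz.hasLyapunov [DecidableEq ι] {A : Matrix ι ι ℝ} (hA : IsHurwitz A) :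
    HasLyapunov A := by
  -- With an empty output the kernel condition is void and the inequality becomes Lyapunov's.
  obtain ⟨P, hP, hpos, τ, δ, hδ, h⟩ := exists_posDef_lmi A (0 : Matrix (Fin 0) ι ℝ)
    fun μ hμ v hv _ => by
      by_contra hv0
      exact absurd (hA μ ((mem_spectrum_complex_iff _ _).2 ⟨v, hv0, hv⟩)) (not_lt.2 hμ)
  refine ⟨P, hP, hpos, δ, hδ, fun x => ?_⟩
  simpa using h x

/-- The Popov–Belevitch–Hautus test for detectability. -/
theorem isDetectable_of_pbh [DecidableEq ι] (A : Matrix ι ι ℝ) (C : Matrix o ι ℝ)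
    (h : ∀ μ : ℂ, 0 ≤ μ.re → ∀ v : ι → ℂ, A.map Complex.ofReal *ᵥ v = μ • v →
      C.map Complex.ofReal *ᵥ v = 0 → v = 0) : IsDetectable A C := by
  obtain ⟨P, hP, hpos, τ, δ, hδ, h⟩ := exists_posDef_lmi A C h
  have hdet : IsUnit P.det := by
    rw [isUnit_iff_ne_zero, ne_eq, ← exists_mulVec_eq_zero_iff]
    rintro ⟨v, hv, hPv⟩
    have := hpos v hv
    simp [hPv] at this
  -- For this gain `2 xᵀ P L C x = τ ‖C x‖²`, which removes the output term of the inequality.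
  refine ⟨(τ / 2) • (P⁻¹ * Cᵀ), HasLyapunov.isHurwitz ⟨P, hP, hpos, δ, hδ, fun x => ?_⟩⟩
  have h1 := h x
  have h2 : P *ᵥ ((A - (τ / 2) • (P⁻¹ * Cᵀ) * C) *ᵥ x) =
      P *ᵥ (A *ᵥ x) - (τ / 2) • (Cᵀ *ᵥ (C *ᵥ x)) := by
    have hPL : P * ((τ / 2) • (P⁻¹ * Cᵀ) * C) = (τ / 2) • (Cᵀ * C) := by
      rw [Matrix.smul_mul, Matrix.mul_smul, Matrix.mul_assoc P⁻¹,
        mul_nonsing_inv_cancel_left _ _ hdet]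
    rw [sub_mulVec, mulVec_sub, mulVec_mulVec _ P ((τ / 2) • (P⁻¹ * Cᵀ) * C), hPL, smul_mulVec,
      mulVec_mulVec _ Cᵀ]
  have h3 : x ⬝ᵥ Cᵀ *ᵥ (C *ᵥ x) = (C *ᵥ x) ⬝ᵥ (C *ᵥ x) := by
    rw [dotProduct_mulVec, vecMul_transpose]
  rw [h2, dotProduct_sub, dotProduct_smul, h3, smul_eq_mul]
  linarith

lemma IsDetectable.eq_zero_of_unstable [DecidableEq ι] {A : Matrix ι ι ℝ} {C : Matrix o ι ℝ}
    (h : IsDetectable A C) {μ : ℂ} (hμ : 0 ≤ μ.re) {v : ι → ℂ}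
    (hA : A.map Complex.ofReal *ᵥ v = μ • v) (hC : C.map Complex.ofReal *ᵥ v = 0) : v = 0 := by
  obtain ⟨L, hL⟩ := h
  by_contra hv
  refine absurd (hL μ ((mem_spectrum_complex_iff _ _).2 ⟨v, hv, ?_⟩)) (not_lt.2 hμ)
  have : (A - L * C).map Complex.ofReal = A.map Complex.ofReal - (L * C).map Complex.ofReal := by
    ext i j; simp
  rw [this, sub_mulVec, ← map_ofReal_mulVec_mul, hC, mulVec_zero, sub_zero, hA]

end LyapunovDuality

/-! ### The SVD algorithm: backstepping along it, and its termination -/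

section SVDSteps

lemma exists_right_inverse_of_rank_eq {n m : ℕ} {Γ : Matrix (Fin n) (Fin m) ℝ}
    (h : Γ.rank = n) : ∃ G : Matrix (Fin m) (Fin n) ℝ, Γ * G = 1 := by
  rw [← Matrix.mulVec_surjective_iff_exists_right_inverse]
  have h1 : LinearMap.range Γ.mulVecLin = ⊤ :=
    Submodule.eq_top_of_finrank_eq (by rw [← Matrix.rank, h]; simp)
  exact LinearMap.range_eq_top.1 h1

/-- The identities through which a decomposition is used. The matrix `G = H₁ Σ⁻¹` realises any
prescribed action along `U₁`, while the input does not enter `U₂ᵀ x`. -/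
lemma svd_reduced {n m r n' m' : ℕ} {Γ : Matrix (Fin n) (Fin m) ℝ}
    {U₁ : Matrix (Fin n) (Fin r) ℝ} {U₂ : Matrix (Fin n) (Fin n') ℝ}
    {H : Matrix (Fin m) (Fin r ⊕ Fin m') ℝ} {σ : Fin r → ℝ}
    (hU : fromCols U₁ U₂ * (fromCols U₁ U₂)ᵀ = 1)
    (hU' : (fromCols U₁ U₂)ᵀ * fromCols U₁ U₂ = 1)
    (hH' : Hᵀ * H = 1) (hσ : ∀ i, 0 < σ i)
    (hsvd : Γ = fromCols U₁ U₂ *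
      (fromBlocks (diagonal σ) 0 0 0 : Matrix (Fin r ⊕ Fin n') (Fin r ⊕ Fin m') ℝ) * Hᵀ) :
    U₁ᵀ * U₁ = 1 ∧ U₂ᵀ * U₂ = 1 ∧ U₂ᵀ * U₁ = 0 ∧ U₁ * U₁ᵀ + U₂ * U₂ᵀ = 1 ∧ U₂ᵀ * Γ = 0 ∧
      ∃ G : Matrix (Fin m) (Fin r) ℝ, Γ * G = U₁ := by
  rw [transpose_fromCols, fromCols_mul_fromRows] at hU
  rw [transpose_fromCols, fromRows_mul_fromCols, ← fromBlocks_one, fromBlocks_inj] at hU'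
  obtain ⟨h11, h12, h21, h22⟩ := hU'
  obtain ⟨H₁, H₂, rfl⟩ : ∃ H₁ H₂, H = fromCols H₁ H₂ := ⟨_, _, (fromCols_toCols H).symm⟩
  rw [transpose_fromCols, fromRows_mul_fromCols, ← fromBlocks_one, fromBlocks_inj] at hH'
  have hΓ : Γ = U₁ * diagonal σ * H₁ᵀ := by
    rw [hsvd, transpose_fromCols, fromCols_mul_fromBlocks, fromCols_mul_fromRows]
    simp
  refine ⟨h11, h22, h21, hU, ?_, H₁ * diagonal fun i => (σ i)⁻¹, ?_⟩
  · rw [hΓ, ← Matrix.mul_assoc, ← Matrix.mul_assoc, h21]; simp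
  · have hd : diagonal σ * diagonal (fun i => (σ i)⁻¹) = 1 := by
      rw [diagonal_mul_diagonal, ← diagonal_one]
      congr 1
      funext i
      exact mul_inv_cancel₀ (hσ i).ne'
    rw [hΓ, Matrix.mul_assoc, ← Matrix.mul_assoc H₁ᵀ, hH'.1, Matrix.one_mul, Matrix.mul_assoc, hd,
      Matrix.mul_one]

/-- Compressions of the powers of `A` along the annihilator of the output. -/
lemma compression_pow {n r n' p l : ℕ} {A : Matrix (Fin n) (Fin n) ℝ}
    {U₁ : Matrix (Fin n) (Fin r) ℝ} {U₂ : Matrix (Fin n) (Fin n') ℝ}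
    {C : Matrix (Fin p) (Fin n) ℝ} (hU : U₁ * U₁ᵀ + U₂ * U₂ᵀ = 1)
    (hC : ∀ i < l, C * A ^ i * U₁ = 0) {i : ℕ} (hi : i < l) :
    C * U₂ * (U₂ᵀ * A * U₂) ^ i * U₂ᵀ = C * A ^ i := by
  have hUU : U₂ * U₂ᵀ = 1 - U₁ * U₁ᵀ := by rw [← hU]; abel
  have key : ∀ j < l, C * A ^ j * (U₂ * U₂ᵀ) = C * A ^ j := fun j hj => by
    rw [hUU, Matrix.mul_sub, ← Matrix.mul_assoc _ U₁, hC j hj]; simp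
  induction i with
  | zero =>
    have := key 0 hi
    simpa [Matrix.mul_assoc] using this
  | succ i ih =>
    have e := ih (by omega)
    calc C * U₂ * (U₂ᵀ * A * U₂) ^ (i + 1) * U₂ᵀ
        = (C * U₂ * (U₂ᵀ * A * U₂) ^ i * U₂ᵀ) * A * (U₂ * U₂ᵀ) := by
          rw [pow_succ]; simp only [Matrix.mul_assoc]
      _ = C * A ^ (i + 1) * (U₂ * U₂ᵀ) := by rw [e, pow_succ]; simp only [Matrix.mul_assoc]
      _ = C * A ^ (i + 1) := key _ hi

/-- Almost disturbance decoupling by high-gain backstepping along the steps of the SVD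
algorithm. -/
theorem SVDStepsTo.exists_strictGain {n m l : ℕ} {A : Matrix (Fin n) (Fin n) ℝ}
    {B : Matrix (Fin n) (Fin m) ℝ} (h : SVDStepsTo A B l) {p q : ℕ}
    (C : Matrix (Fin p) (Fin n) ℝ) (R : Matrix (Fin n) (Fin q) ℝ)
    (hC : ∀ i < l, C * A ^ i * B = 0) {b : ℝ} (hb : 0 < b) :
    ∃ K : Matrix (Fin m) (Fin n) ℝ, StrictGain (A + B * K) R C 1 b := by
  induction h with
  | done Φ Γ hrank =>
    obtain ⟨G, hG⟩ := exists_right_inverse_of_rank_eq hrank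
    obtain ⟨k, hk⟩ := strictGain_neg_smul_one R C hb zero_le_one
    -- With full row rank the feedback replaces the whole state matrix by `-k • 1`.
    refine ⟨G * (-k • 1 - Φ), ?_⟩
    rw [← Matrix.mul_assoc, hG, Matrix.one_mul, add_sub_cancel]
    exact hk
  | @step n m r n' m' l A B U₁ U₂ H σ hrank hne hU hU' hH hH' hσ hsvd hnext ih =>
    obtain ⟨h11, h22, h21, hUU, hUB, G, hG⟩ := svd_reduced hU hU' hH' hσ hsvd
    have hCU : ∀ i < l + 1, C * A ^ i * U₁ = 0 := fun i hi => by
      rw [← hG, ← Matrix.mul_assoc, hC i hi, Matrix.zero_mul]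
    -- Design for `U₂ᵀ x` with `U₁ᵀ x` as virtual input. Its Markov parameters are those of `A`
    -- shifted by one power, so one step fewer needs one vanishing product fewer.
    obtain ⟨K₁, hK₁⟩ := ih (C * U₂) (U₂ᵀ * R) fun i hi => by
      have e := compression_pow hUU hCU (show i < l + 1 by omega)
      have e2 := hCU (i + 1) (by omega)
      calc C * U₂ * (U₂ᵀ * A * U₂) ^ i * (U₂ᵀ * A * U₁)
          = (C * U₂ * (U₂ᵀ * A * U₂) ^ i * U₂ᵀ) * A * U₁ := by simp only [Matrix.mul_assoc]
        _ = C * A ^ (i + 1) * U₁ := by rw [e, pow_succ]; simp only [Matrix.mul_assoc]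
        _ = 0 := e2
    -- `Y x` is the deviation of `U₁ᵀ x` from the virtual law `K₁ U₂ᵀ x`.
    set Y : Matrix (Fin r) (Fin n) ℝ := U₁ᵀ - K₁ * U₂ᵀ with hY
    obtain ⟨k, hk⟩ := hK₁.backstep (U₂ᵀ * A * U₁) (Y * R)
    have hYB : Y * B * G = 1 := by
      rw [hY, Matrix.sub_mul, Matrix.mul_assoc K₁, hUB, Matrix.mul_zero, sub_zero,
        Matrix.mul_assoc, hG, h11]
    have hUA : U₂ᵀ * A = U₂ᵀ * A * U₁ * U₁ᵀ + U₂ᵀ * A * U₂ * U₂ᵀ := by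
      rw [Matrix.mul_assoc _ U₁, Matrix.mul_assoc _ U₂, ← Matrix.mul_add, hUU, Matrix.mul_one]
    -- As `Y B G = 1`, this feedback gives `Y (A + B K) = -k Y`: in the coordinates `(U₂ᵀ x, Y x)`
    -- the closed loop is the backstepping system.
    refine ⟨G * (-k • Y - Y * A), hk.of_similar (fromRows U₂ᵀ Y) (fromCols (U₂ + U₁ * K₁) U₁)
      ?_ ?_ ?_ ?_⟩
    · rw [fromCols_mul_fromRows, hY, Matrix.add_mul, Matrix.mul_sub, ← hUU, Matrix.mul_assoc]
      abel
    · rw [fromRows_mul, ← fromCols_fromRows_eq_fromBlocks, fromCols_mul_fromRows, fromRows_mul,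
        fromRows_mul]
      rw [show ∀ (a b : Matrix (Fin n') (Fin n) ℝ) (c d : Matrix (Fin r) (Fin n) ℝ),
        fromRows a c + fromRows b d = fromRows (a + b) (c + d) from fun a b c d => by
          ext (i | i) j <;> rfl]
      congr 1
      · rw [Matrix.mul_add, ← Matrix.mul_assoc, hUB, Matrix.zero_mul, add_zero, hY]
        conv_lhs => rw [hUA]
        simp only [Matrix.add_mul, Matrix.mul_sub, Matrix.mul_assoc]
        abel
      · rw [Matrix.mul_add, ← Matrix.mul_assoc, ← Matrix.mul_assoc, hYB]
        simp
    · rw [fromRows_mul]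
    · rw [fromCols_mul_fromRows, Matrix.zero_mul, add_zero]
      have := compression_pow hUU hCU (Nat.succ_pos l)
      simpa using this.symm

/-- Existence of a singular value decomposition. -/
lemma exists_svd {n m : ℕ} (Γ : Matrix (Fin n) (Fin m) ℝ) :
    ∃ (r n' m' : ℕ) (U₁ : Matrix (Fin n) (Fin r) ℝ) (U₂ : Matrix (Fin n) (Fin n') ℝ)
      (H : Matrix (Fin m) (Fin r ⊕ Fin m') ℝ) (σ : Fin r → ℝ),
      fromCols U₁ U₂ * (fromCols U₁ U₂)ᵀ = 1 ∧ (fromCols U₁ U₂)ᵀ * fromCols U₁ U₂ = 1 ∧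
      H * Hᵀ = 1 ∧ Hᵀ * H = 1 ∧ (∀ i, 0 < σ i) ∧ r + n' = n ∧
      Γ = fromCols U₁ U₂ *
        (fromBlocks (diagonal σ) 0 0 0 : Matrix (Fin r ⊕ Fin n') (Fin r ⊕ Fin m') ℝ) * Hᵀ := by
  -- `H` consists of eigenvectors of `Γᵀ Γ`, nonzero eigenvalues first. The columns of `Γ H` are
  -- orthogonal with the eigenvalues as squared norms: the nonzero ones, normalised, give `U₁` and
  -- are completed to an orthonormal basis, the others vanish.
  have hpsd : (Γᵀ * Γ).PosSemidef := by
    have := posSemidef_conjTranspose_mul_self Γ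
    rwa [conjTranspose_eq_transpose_of_trivial] at this
  set ev := hpsd.isHermitian.eigenvalues with hev
  have hev0 : ∀ i, 0 ≤ ev i := hpsd.eigenvalues_nonneg
  set V : Matrix (Fin m) (Fin m) ℝ := hpsd.isHermitian.eigenvectorUnitary.1 with hV
  have hVV : Vᵀ * V = 1 := by
    have := Unitary.coe_star_mul_self hpsd.isHermitian.eigenvectorUnitary
    rwa [star_eq_conjTranspose, conjTranspose_eq_transpose_of_trivial] at this
  have hspec : Vᵀ * (Γᵀ * Γ) * V = diagonal ev := by
    have := hpsd.isHermitian.conjStarAlgAut_star_eigenvectorUnitary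
    rw [Unitary.conjStarAlgAut_apply, Unitary.coe_star, star_star, star_eq_conjTranspose,
      conjTranspose_eq_transpose_of_trivial] at this
    exact this
  set r := Fintype.card {i // ev i ≠ 0} with hr
  set m' := Fintype.card {i // ¬ ev i ≠ 0} with hm'
  let e : Fin r ⊕ Fin m' ≃ Fin m :=
    (Equiv.sumCongr (Fintype.equivFin _).symm (Fintype.equivFin _).symm).trans
      (Equiv.sumCompl fun i => ev i ≠ 0)
  have heinl : ∀ i : Fin r, ev (e (Sum.inl i)) ≠ 0 := fun i =>
    ((Fintype.equivFin {i // ev i ≠ 0}).symm i).2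
  have heinr : ∀ i : Fin m', ev (e (Sum.inr i)) = 0 := fun i =>
    not_not.1 ((Fintype.equivFin {i // ¬ ev i ≠ 0}).symm i).2
  set H : Matrix (Fin m) (Fin r ⊕ Fin m') ℝ := V.submatrix id e with hHdef
  have hH' : Hᵀ * H = 1 := by
    rw [hHdef, transpose_submatrix, ← submatrix_mul _ _ _ _ _ Function.bijective_id, hVV,
      submatrix_one_equiv]
  have hH : H * Hᵀ = 1 := by
    rw [hHdef, transpose_submatrix, submatrix_mul_equiv, mul_eq_one_comm.1 hVV, submatrix_id_id]
  set W := Γ * H with hW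
  have hWW : ∀ j k, ∑ i, W i j * W i k = if j = k then ev (e j) else 0 := fun j k => by
    have h1 : Wᵀ * W = diagonal (ev ∘ e) := by
      rw [hW, transpose_mul, hHdef, transpose_submatrix]
      have : (Vᵀ * Γᵀ * (Γ * V)).submatrix e e = diagonal (ev ∘ e) := by
        rw [← submatrix_diagonal_equiv, ← hspec]
        simp only [Matrix.mul_assoc]
      rw [← this]
      ext a b
      simp [Matrix.mul_apply]
    have := congrFun (congrFun h1 j) k
    simpa [Matrix.mul_apply, diagonal_apply] using this
  set σ : Fin r → ℝ := fun i => √(ev (e (Sum.inl i))) with hσdef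
  have hσ : ∀ i, 0 < σ i := fun i =>
    Real.sqrt_pos.2 (lt_of_le_of_ne (hev0 _) (heinl i).symm)
  have hσσ : ∀ i, σ i * σ i = ev (e (Sum.inl i)) := fun i => Real.mul_self_sqrt (hev0 _)
  let u : Fin r → EuclideanSpace ℝ (Fin n) := fun i =>
    WithLp.toLp 2 fun k => W k (Sum.inl i) / σ i
  have hu : Orthonormal ℝ u := by
    rw [orthonormal_iff_ite]
    intro i j
    have h1 : inner ℝ (u i) (u j) =
        (∑ k, W k (Sum.inl i) * W k (Sum.inl j)) / (σ i * σ j) := by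
      rw [PiLp.inner_apply, Finset.sum_div]
      refine Finset.sum_congr rfl fun k _ => ?_
      simp only [u, RCLike.inner_apply, conj_trivial]
      rw [div_mul_div_comm, mul_comm, mul_comm (σ j)]
    rw [h1, hWW]
    by_cases hij : i = j
    · subst hij
      simp only [if_true, hσσ]
      exact div_self (heinl i)
    · simp [hij]
  have hrn : r ≤ n := by
    simpa using hu.linearIndependent.fintype_card_le_finrank
  have hres : Orthonormal ℝ ((Set.range (Sum.inl : Fin r → Fin r ⊕ Fin (n - r))).domRestrict
      (Sum.elim u fun _ => 0)) := by
    rw [orthonormal_iff_ite] at hu ⊢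
    rintro ⟨_, i, rfl⟩ ⟨_, j, rfl⟩
    refine (hu i j).trans ?_
    by_cases hij : i = j
    · subst hij; simp
    · rw [if_neg hij, if_neg fun h => hij (Sum.inl_injective (Subtype.ext_iff.1 h))]
  obtain ⟨bas, hbas⟩ := hres.exists_orthonormalBasis_extension_of_card_eq (by simp; omega)
  set U : Matrix (Fin n) (Fin r ⊕ Fin (n - r)) ℝ := of fun k j => bas j k with hUdef
  have hU' : Uᵀ * U = 1 := by
    ext j k
    have := orthonormal_iff_ite.1 bas.orthonormal j k
    rw [PiLp.inner_apply] at this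
    simp only [RCLike.inner_apply, conj_trivial] at this
    rw [Matrix.one_apply, ← this, Matrix.mul_apply]
    exact Finset.sum_congr rfl fun i _ => mul_comm _ _
  have hU : U * Uᵀ = 1 := by
    refine (mul_eq_one_comm_of_equiv (finSumFinEquiv.trans (finCongr (by omega)))).1 hU'
  have hUW : ∀ k i, U k (Sum.inl i) * σ i = W k (Sum.inl i) := fun k i => by
    have : bas (Sum.inl i) = u i := hbas _ ⟨i, rfl⟩
    rw [hUdef, of_apply, this]
    exact div_mul_cancel₀ _ (hσ i).ne'
  have hW0 : ∀ k j, W k (Sum.inr j) = 0 := fun k j => by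
    have h1 := hWW (Sum.inr j) (Sum.inr j)
    rw [if_pos rfl, heinr, Finset.sum_eq_zero_iff_of_nonneg fun i _ => mul_self_nonneg _] at h1
    exact mul_self_eq_zero.1 (h1 k (Finset.mem_univ k))
  refine ⟨r, n - r, m', U.toCols₁, U.toCols₂, H, σ, ?_, ?_, hH, hH', hσ, by omega, ?_⟩
  · rw [fromCols_toCols, hU]
  · rw [fromCols_toCols, hU']
  · have : fromCols U.toCols₁ U.toCols₂ *
        (fromBlocks (diagonal σ) 0 0 0 : Matrix (Fin r ⊕ Fin (n - r)) (Fin r ⊕ Fin m') ℝ) = W := by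
      rw [fromCols_mul_fromBlocks]
      ext k (i | j)
      · simpa [mul_diagonal, toCols₁] using hUW k i
      · simp [hW0]
    rw [this, hW, Matrix.mul_assoc, hH, Matrix.mul_one]

/-- The algorithm reaches full row rank when no row vector annihilates all `A ^ k * B`. -/
lemma exists_SVDStepsTo {n m : ℕ} (A : Matrix (Fin n) (Fin n) ℝ) (B : Matrix (Fin n) (Fin m) ℝ)
    (h : ∀ v : Fin n → ℝ, (∀ k : ℕ, v ᵥ* (A ^ k * B) = 0) → v = 0) :
    ∃ l, SVDStepsTo A B l := by
  induction n using Nat.strong_induction_on generalizing m with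
  | _ n ih =>
    by_cases hrank : B.rank = n
    · exact ⟨0, .done A B hrank⟩
    -- A zero `B` makes every row vector annihilating, so `n = 0` and the rank is already full.
    have hne : B ≠ 0 := by
      rintro rfl
      apply hrank
      rw [Matrix.rank_zero]
      by_contra hn
      have h1 := h 1 (by simp)
      exact one_ne_zero (congrFun h1 ⟨0, by omega⟩)
    obtain ⟨r, n', m', U₁, U₂, H, σ, hU, hU', hH, hH', hσ, hrn, hsvd⟩ := exists_svd B
    obtain ⟨h11, h22, h21, hUU, hUB, G, hG⟩ := svd_reduced hU hU' hH' hσ hsvd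
    have hr : r ≠ 0 := by
      rintro rfl
      apply hne
      have h0 : (fromBlocks (diagonal σ) 0 0 0 :
          Matrix (Fin 0 ⊕ Fin n') (Fin 0 ⊕ Fin m') ℝ) = 0 := by
        ext (i | i) (j | j)
        · exact i.elim0
        all_goals rfl
      rw [hsvd, h0, Matrix.mul_zero, Matrix.zero_mul]
    obtain ⟨l, hl⟩ := ih n' (by omega) (U₂ᵀ * A * U₂) (U₂ᵀ * A * U₁) fun v hv => by
      -- If `v` annihilates the compressed pair, the component along `U₁ᵀ` drops out at each power.
      -- So `v U₂ᵀ` annihilates every `A ^ k B`, because `U₂ᵀ B = 0`.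
      have hpow : ∀ k : ℕ, (v ᵥ* U₂ᵀ) ᵥ* A ^ k = v ᵥ* ((U₂ᵀ * A * U₂) ^ k * U₂ᵀ) := fun k => by
        induction k with
        | zero => simp
        | succ k ihk =>
          have e : (U₂ᵀ * A * U₂) ^ k * U₂ᵀ * A =
              (U₂ᵀ * A * U₂) ^ k * (U₂ᵀ * A * U₁) * U₁ᵀ + (U₂ᵀ * A * U₂) ^ (k + 1) * U₂ᵀ := by
            calc (U₂ᵀ * A * U₂) ^ k * U₂ᵀ * A
                = (U₂ᵀ * A * U₂) ^ k * U₂ᵀ * A * (U₁ * U₁ᵀ + U₂ * U₂ᵀ) := by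
                  rw [hUU, Matrix.mul_one]
              _ = _ := by rw [pow_succ, Matrix.mul_add]; simp only [Matrix.mul_assoc]
          rw [pow_succ, ← vecMul_vecMul, ihk, vecMul_vecMul, e, vecMul_add, ← vecMul_vecMul _ _ U₁ᵀ,
            hv k]
          simp
      have h1 : v ᵥ* U₂ᵀ = 0 := h _ fun k => by
        rw [← vecMul_vecMul, hpow, vecMul_vecMul, Matrix.mul_assoc, hUB]
        simp
      have h2 : v ᵥ* U₂ᵀ ᵥ* U₂ = v := by rw [vecMul_vecMul, h22, vecMul_one]
      rw [← h2, h1, zero_vecMul]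
    exact ⟨l + 1, .step A B U₁ U₂ H σ hrank hne hU hU' hH hH' hσ hsvd hl⟩

lemma IsControllable.eq_zero_of_forall_vecMul {ι κ : Type*} [Fintype ι] [DecidableEq ι]
    [Fintype κ] {A : Matrix ι ι ℝ} {B : Matrix ι κ ℝ} (h : IsControllable A B) {v : ι → ℝ}
    (hv : ∀ k : ℕ, v ᵥ* (A ^ k * B) = 0) : v = 0 := by
  have hli : LinearIndependent ℝ (ctrbMatrix A B).row := by
    rw [linearIndependent_iff_card_eq_finrank_span, Set.finrank, ← Matrix.rank_eq_finrank_span_row]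
    exact h.symm
  refine Matrix.vecMul_injective_iff.2 hli ?_
  simp only [zero_vecMul]
  funext kj
  exact congrFun (hv kj.1) kj.2

/-- The infimum of a nonempty set of naturals is attained, so one run of this length suffices;
independence of the chosen decompositions is not needed. -/
lemma IsControllable.SVDStepsTo_numSVDSteps {n m : ℕ} {A : Matrix (Fin n) (Fin n) ℝ}
    {B : Matrix (Fin n) (Fin m) ℝ} (h : IsControllable A B) :
    SVDStepsTo A B (numSVDSteps A B) :=
  Nat.sInf_mem (exists_SVDStepsTo A B fun _ hv => h.eq_zero_of_forall_vecMul hv)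

end SVDSteps

/-! ### Spectrum and observability of the internal model; detectability of the augmented pair -/

section InternalModel

lemma mulVec_eq_zero_of_rank_eq_card {ι κ : Type*} [Fintype ι] [Fintype κ]
    {F : Matrix κ ι ℂ} (h : F.rank = Fintype.card ι) {v : ι → ℂ} (hv : F *ᵥ v = 0) : v = 0 := by
  have h1 := F.mulVecLin.finrank_range_add_finrank_ker
  rw [← Matrix.rank, h, Module.finrank_fintype_fun_eq_card] at h1
  have h2 : LinearMap.ker F.mulVecLin = ⊥ := Submodule.finrank_eq_zero.1 (by omega)
  exact LinearMap.ker_eq_bot'.1 h2 v hv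

lemma ZeroRankCondition.eq_zero {n m p d : ℕ} {Ao : Matrix (Fin d) (Fin d) ℝ}
    {A : Matrix (Fin n) (Fin n) ℝ} {B : Matrix (Fin n) (Fin m) ℝ} {C : Matrix (Fin p) (Fin n) ℝ}
    (hZ : ZeroRankCondition Ao A B C) {μ : ℂ} (hμ : μ ∈ spectrum ℂ (Ao.map Complex.ofReal))
    {x : Fin n → ℂ} {u : Fin m → ℂ}
    (hAx : A.map Complex.ofReal *ᵥ x + B.map Complex.ofReal *ᵥ u = μ • x)
    (hCx : C.map Complex.ofReal *ᵥ x = 0) : x = 0 ∧ u = 0 := by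
  have h1 : Sum.elim x u = 0 := by
    refine mulVec_eq_zero_of_rank_eq_card
      ((hZ μ hμ).trans (by simp)) ?_
    rw [fromBlocks_mulVec]
    simp only [Sum.elim_comp_inl, Sum.elim_comp_inr, sub_mulVec, smul_mulVec, one_mulVec,
      zero_mulVec, add_zero, hCx]
    rw [sub_add_eq_add_sub, hAx, sub_self]
    funext i
    cases i <;> rfl
  exact ⟨funext fun i => congrFun h1 (Sum.inl i), funext fun i => congrFun h1 (Sum.inr i)⟩

variable {d : ℕ} {Ao : Matrix (Fin d) (Fin d) ℝ}

/-- The superdiagonal rows force an eigenvector to be a geometric progression. It is determined by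
its first entry, which `Ψ` reads off. -/
lemma companionOf_mulVec_apply_of_lt {μ : ℂ} {y : Fin (minDeg Ao) → ℂ}
    (hy : (companionOf Ao).map Complex.ofReal *ᵥ y = μ • y) (k : ℕ) (hk : k < minDeg Ao) :
    y ⟨k, hk⟩ = μ ^ k * y ⟨0, by omega⟩ := by
  induction k with
  | zero => simp
  | succ k ih =>
    have h1 := congrFun hy ⟨k, by omega⟩
    have h2 : ((companionOf Ao).map Complex.ofReal *ᵥ y) ⟨k, by omega⟩ = y ⟨k + 1, hk⟩ := by
      rw [mulVec, dotProduct, Finset.sum_eq_single ⟨k + 1, hk⟩]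
      · simp [companionOf, hk.ne]
      · intro j _ hj
        have : (j : ℕ) ≠ k + 1 := fun h => hj (Fin.ext h)
        simp [companionOf, hk.ne, this]
      · simp
    rw [← h2, h1, Pi.smul_apply, smul_eq_mul, ih (by omega), pow_succ]
    ring

/-- Once the entries are powers of `μ`, the last row of the companion matrix is the equation of the
minimal polynomial. -/
lemma aeval_minpoly_of_companionOf_mulVec {μ : ℂ} {y : Fin (minDeg Ao) → ℂ} (hy0 : y ≠ 0)
    (hy : (companionOf Ao).map Complex.ofReal *ᵥ y = μ • y) :
    Polynomial.aeval μ (minpoly ℝ Ao) = 0 := by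
  have hpow := companionOf_mulVec_apply_of_lt hy
  have hs : 0 < minDeg Ao := by
    by_contra! h0
    exact hy0 (funext fun i => absurd i.2 (by omega))
  have hy00 : y ⟨0, hs⟩ ≠ 0 := fun h0 => hy0 (funext fun i => by
    rw [← Fin.eta i i.2, hpow i i.2, h0, mul_zero]; rfl)
  have h1 := congrFun hy ⟨minDeg Ao - 1, by omega⟩
  have hlast : minDeg Ao - 1 + 1 = minDeg Ao := by omega
  have h2 : ((companionOf Ao).map Complex.ofReal *ᵥ y) ⟨minDeg Ao - 1, by omega⟩ =
      -(∑ k ∈ Finset.range (minDeg Ao), ((minpoly ℝ Ao).coeff k : ℂ) * μ ^ k) * y ⟨0, hs⟩ := by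
    rw [mulVec, dotProduct, ← Fin.sum_univ_eq_sum_range
      (fun k => ((minpoly ℝ Ao).coeff k : ℂ) * μ ^ k), ← Finset.sum_neg_distrib, Finset.sum_mul]
    refine Finset.sum_congr rfl fun k _ => ?_
    rw [← Fin.eta k k.2, hpow k k.2]
    simp [companionOf, hlast]
    ring
  rw [h2, Pi.smul_apply, hpow (minDeg Ao - 1) (by omega), smul_eq_mul, ← mul_assoc,
    ← pow_succ', hlast] at h1
  have h3 := mul_right_cancel₀ hy00 h1
  have hmonic : (minpoly ℝ Ao).coeff (minDeg Ao) = 1 :=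
    (minpoly.monic (Matrix.isIntegral Ao)).coeff_natDegree
  rw [Polynomial.aeval_eq_sum_range, Finset.sum_range_succ]
  simp only [Algebra.smul_def, Complex.coe_algebraMap]
  rw [hmonic, ← h3]
  simp

lemma mem_spectrum_of_aeval_minpoly {μ : ℂ} (h : Polynomial.aeval μ (minpoly ℝ Ao) = 0) :
    μ ∈ spectrum ℂ (Ao.map Complex.ofReal) := by
  refine Matrix.mem_spectrum_of_isRoot_charpoly ?_
  have h1 : (Ao.map Complex.ofReal).charpoly = Ao.charpoly.map Complex.ofRealHom :=
    Matrix.charpoly_map Ao Complex.ofRealHom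
  obtain ⟨g, hg⟩ := Matrix.minpoly_dvd_charpoly Ao
  rw [Polynomial.IsRoot, h1, Polynomial.eval_map, hg, Polynomial.eval₂_mul]
  have : Polynomial.eval₂ Complex.ofRealHom μ (minpoly ℝ Ao) = 0 := h
  rw [this, zero_mul]

lemma imPhi_mulVec {m : ℕ} (y : Fin m × Fin (minDeg Ao) → ℂ) (i : Fin m)
    (k : Fin (minDeg Ao)) : ((imPhi m Ao).map Complex.ofReal *ᵥ y) (i, k) =
      ((companionOf Ao).map Complex.ofReal *ᵥ fun k => y (i, k)) k := by
  simp only [mulVec, dotProduct, Fintype.sum_prod_type, imPhi, map_apply, kroneckerMap_apply]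
  rw [Finset.sum_eq_single i]
  · simp
  · intro j _ hj
    simp [Matrix.one_apply_ne hj.symm]
  · simp

lemma imPsi_mulVec {m : ℕ} (y : Fin m × Fin (minDeg Ao) → ℂ) (i : Fin m)
    (hs : 0 < minDeg Ao) : ((imPsi m Ao).map Complex.ofReal *ᵥ y) i = y (i, ⟨0, hs⟩) := by
  simp only [mulVec, dotProduct, imPsi, map_apply, submatrix_apply, kroneckerMap_apply, id]
  rw [Finset.sum_eq_single (i, ⟨0, hs⟩)]
  · simp
  · rintro ⟨j, k⟩ _ hjk
    by_cases hj : i = j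
    · subst hj
      have : (k : ℕ) ≠ 0 := fun h => hjk (Prod.ext rfl (Fin.ext h))
      simp [this]
    · simp [Matrix.one_apply_ne hj]
  · simp

/-- The pair `(Φ, Ψ)` is observable. -/
lemma eq_zero_of_imPhi_imPsi {m : ℕ} {μ : ℂ} {y : Fin m × Fin (minDeg Ao) → ℂ}
    (hΦ : (imPhi m Ao).map Complex.ofReal *ᵥ y = μ • y)
    (hΨ : (imPsi m Ao).map Complex.ofReal *ᵥ y = 0) : y = 0 := by
  funext ⟨i, k⟩
  have h1 : (companionOf Ao).map Complex.ofReal *ᵥ (fun k => y (i, k)) =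
      μ • fun k => y (i, k) := funext fun k => by
    rw [← imPhi_mulVec, hΦ]; rfl
  have h2 := companionOf_mulVec_apply_of_lt h1 k k.2
  have h3 := imPsi_mulVec y i (Nat.zero_lt_of_lt k.2)
  rw [hΨ] at h3
  rw [Fin.eta] at h2
  rw [h2, ← h3]
  simp

/-- Eigenvalues of `Φ` are eigenvalues of `Ao`. -/
lemma mem_spectrum_of_imPhi {m : ℕ} {μ : ℂ} {y : Fin m × Fin (minDeg Ao) → ℂ} (hy : y ≠ 0)
    (hΦ : (imPhi m Ao).map Complex.ofReal *ᵥ y = μ • y) :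
    μ ∈ spectrum ℂ (Ao.map Complex.ofReal) := by
  obtain ⟨⟨i, k⟩, hik⟩ := Function.ne_iff.1 hy
  refine mem_spectrum_of_aeval_minpoly
    (aeval_minpoly_of_companionOf_mulVec (y := fun k => y (i, k))
      (fun h0 => hik (congrFun h0 k)) (funext fun k => ?_))
  rw [← imPhi_mulVec, hΦ]; rfl

/-- The Sylvester equation gives `M + N Ψ T⁻¹ = T Φ T⁻¹`. An unstable unobservable mode with zero
model part contradicts detectability of `(A, C)`; otherwise its eigenvalue is one of `Ao`, the rank
condition gives `Ψ y = 0`, and observability of `(Φ, Ψ)` gives `y = 0`. -/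
theorem isDetectable_aug {n m p : ℕ} {A : Matrix (Fin n) (Fin n) ℝ}
    {B : Matrix (Fin n) (Fin m) ℝ} {C : Matrix (Fin p) (Fin n) ℝ}
    (hZ : ZeroRankCondition Ao A B C) (hdet : IsDetectable A C)
    {M T : Matrix (Fin m × Fin (minDeg Ao)) (Fin m × Fin (minDeg Ao)) ℝ}
    {N : Matrix (Fin m × Fin (minDeg Ao)) (Fin m) ℝ} (hT : IsUnit T.det)
    (hSyl : T * imPhi m Ao - M * T = N * imPsi m Ao) :
    IsDetectable (augA A B M N (imPsi m Ao * T⁻¹)) (augC _ C) := by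
  have hTΦ : T⁻¹ * (M + N * (imPsi m Ao * T⁻¹)) = imPhi m Ao * T⁻¹ := by
    rw [← Matrix.mul_assoc N, ← hSyl, Matrix.sub_mul, mul_nonsing_inv_cancel_right _ _ hT,
      add_sub_cancel, Matrix.mul_assoc, nonsing_inv_mul_cancel_left _ _ hT]
  refine isDetectable_of_pbh _ _ fun μ hμ v hv hCv => ?_
  obtain ⟨x, z, rfl⟩ : ∃ x z, v = Sum.elim x z := ⟨_, _, (Sum.elim_comp_inl_inr v).symm⟩
  rw [augA, fromBlocks_map, fromBlocks_mulVec] at hv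
  rw [augC, show (fromCols C (0 : Matrix (Fin p) (Fin m × Fin (minDeg Ao)) ℝ)).map
    Complex.ofReal = fromCols (C.map Complex.ofReal) 0 by ext i (j | j) <;> simp,
    fromCols_mulVec] at hCv
  simp only [Sum.elim_comp_inl, Sum.elim_comp_inr, zero_mulVec, add_zero] at hv hCv
  have hx : A.map Complex.ofReal *ᵥ x + (B * (imPsi m Ao * T⁻¹)).map Complex.ofReal *ᵥ z =
      μ • x := funext fun i => congrFun hv (Sum.inl i)
  have hz : (M + N * (imPsi m Ao * T⁻¹)).map Complex.ofReal *ᵥ z = μ • z :=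
    funext fun i => by
      have := congrFun hv (Sum.inr i)
      simpa [Matrix.map_zero] using this
  set y := T⁻¹.map Complex.ofReal *ᵥ z with hy
  have hΦ : (imPhi m Ao).map Complex.ofReal *ᵥ y = μ • y := by
    rw [hy, map_ofReal_mulVec_mul, ← hTΦ, ← map_ofReal_mulVec_mul, hz, mulVec_smul]
  have hzy : z = T.map Complex.ofReal *ᵥ y := by
    rw [hy, map_ofReal_mulVec_mul, mul_nonsing_inv _ hT]
    rw [Matrix.map_one _ Complex.ofReal_zero Complex.ofReal_one, one_mulVec]
  rw [← map_ofReal_mulVec_mul, ← map_ofReal_mulVec_mul, ← hy] at hx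
  by_cases hy0 : y = 0
  · have hz0 : z = 0 := by rw [hzy, hy0, mulVec_zero]
    rw [hy0, mulVec_zero, mulVec_zero, add_zero] at hx
    rw [hz0, hdet.eq_zero_of_unstable hμ hx hCv]
    funext i
    cases i <;> rfl
  · obtain ⟨-, hΨ⟩ := hZ.eq_zero (mem_spectrum_of_imPhi hy0 hΦ) hx hCv
    exact absurd (eq_zero_of_imPhi_imPsi hΦ hΨ) hy0

end InternalModel

/-! ### Uniqueness and continuity of the regulator solution -/

section Regulator

/-- Complex homogeneous solutions form a space invariant under right multiplication by `Ao`. In a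
nonzero one pick an eigenvector: a nonzero row is a left eigenvector of `Ao`, so `μ` is in its
spectrum, and the rank condition at `μ` then kills every column. -/
lemma regulator_unique {n m p d : ℕ} {Ao : Matrix (Fin d) (Fin d) ℝ}
    {A : Matrix (Fin n) (Fin n) ℝ} {B : Matrix (Fin n) (Fin m) ℝ} {C : Matrix (Fin p) (Fin n) ℝ}
    (hZ : ZeroRankCondition Ao A B C) {X : Matrix (Fin n) (Fin d) ℝ}
    {U : Matrix (Fin m) (Fin d) ℝ} (h : X * Ao = A * X + B * U) (hC : C * X = 0) :
    X = 0 ∧ U = 0 := by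
  let Aoc := Ao.map Complex.ofReal
  let f : Module.End ℂ (Matrix (Fin n) (Fin d) ℂ × Matrix (Fin m) (Fin d) ℂ) :=
    { toFun := fun Y => (Y.1 * Aoc, Y.2 * Aoc)
      map_add' := fun Y Y' => by simp [Matrix.add_mul]
      map_smul' := fun c Y => by simp }
  let W : Submodule ℂ (Matrix (Fin n) (Fin d) ℂ × Matrix (Fin m) (Fin d) ℂ) :=
    { carrier := {Y | Y.1 * Aoc = A.map Complex.ofReal * Y.1 + B.map Complex.ofReal * Y.2 ∧
        C.map Complex.ofReal * Y.1 = 0}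
      add_mem' := by
        rintro Y Y' ⟨h1, h2⟩ ⟨h1', h2'⟩
        refine ⟨?_, ?_⟩
        · simp only [Prod.fst_add, Prod.snd_add, Matrix.add_mul, Matrix.mul_add, h1, h1']
          abel
        · simp only [Prod.fst_add, Matrix.mul_add, h2, h2', add_zero]
      zero_mem' := by simp
      smul_mem' := by
        rintro c Y ⟨h1, h2⟩
        refine ⟨?_, ?_⟩
        · simp only [Prod.smul_fst, Prod.smul_snd, Matrix.smul_mul, Matrix.mul_smul, h1, smul_add]
        · simp only [Prod.smul_fst, Matrix.mul_smul, h2, smul_zero] }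
  have hmap : ∀ {a b c : ℕ} (P : Matrix (Fin a) (Fin b) ℝ) (Q : Matrix (Fin b) (Fin c) ℝ),
      (P * Q).map Complex.ofReal = P.map Complex.ofReal * Q.map Complex.ofReal :=
    fun P Q => Matrix.map_mul (f := Complex.ofRealHom)
  have hmem : (X.map Complex.ofReal, U.map Complex.ofReal) ∈ W := by
    refine ⟨?_, ?_⟩
    · change X.map Complex.ofReal * Ao.map Complex.ofReal = _
      rw [← hmap, ← hmap, ← hmap, h]
      ext i j
      simp
    · change C.map Complex.ofReal * X.map Complex.ofReal = 0
      rw [← hmap, hC]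
      ext i j
      simp
  have hbot : W = ⊥ := by
    by_contra hne
    obtain ⟨μ, ⟨X', U'⟩, ⟨h1, h2⟩, hv0, hfv⟩ := exists_eigenvector_mem_of_invariant f W
      (by
        rintro ⟨X', U'⟩ ⟨h1, h2⟩
        refine ⟨?_, ?_⟩
        · change X' * Aoc * Aoc = A.map Complex.ofReal * (X' * Aoc) +
            B.map Complex.ofReal * (U' * Aoc)
          have h1' : X' * Aoc = A.map Complex.ofReal * X' + B.map Complex.ofReal * U' := h1
          conv_lhs => rw [h1']
          rw [Matrix.add_mul, Matrix.mul_assoc, Matrix.mul_assoc]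
        · change C.map Complex.ofReal * (X' * Aoc) = 0
          have h2' : C.map Complex.ofReal * X' = 0 := h2
          rw [← Matrix.mul_assoc, h2', Matrix.zero_mul]) hne
    have hX : X' * Aoc = μ • X' := congrArg Prod.fst hfv
    have hU : U' * Aoc = μ • U' := congrArg Prod.snd hfv
    have hμ : μ ∈ spectrum ℂ Aoc := by
      rw [spectrum.mem_iff, Matrix.isUnit_iff_isUnit_det, isUnit_iff_ne_zero, not_not,
        ← Matrix.exists_vecMul_eq_zero_iff]
      have hrow : ∀ {a : ℕ} (Y : Matrix (Fin a) (Fin d) ℂ), Y * Aoc = μ • Y → ∀ i,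
          Y i ᵥ* (algebraMap ℂ (Matrix (Fin d) (Fin d) ℂ) μ - Aoc) = 0 := fun Y hY i => by
        have : Y i ᵥ* Aoc = μ • Y i := congrFun hY i
        rw [vecMul_sub, this, Algebra.algebraMap_eq_smul_one, vecMul_smul, vecMul_one, sub_self]
      by_contra! hno
      apply hv0
      refine Prod.ext ?_ ?_
      · funext i
        by_contra hi
        exact hno _ hi (hrow X' hX i)
      · funext i
        by_contra hi
        exact hno _ hi (hrow U' hU i)
    apply hv0
    have hcol : ∀ j, (fun i => X' i j) = 0 ∧ (fun i => U' i j) = 0 := fun j => by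
      refine hZ.eq_zero hμ ?_ ?_
      · funext i
        have h1' := congrFun (congrFun (hX.symm.trans h1) i) j
        exact h1'.symm
      · funext i
        exact congrFun (congrFun h2 i) j
    refine Prod.ext ?_ ?_
    · ext i j; exact congrFun (hcol j).1 i
    · ext i j; exact congrFun (hcol j).2 i
  rw [hbot, Submodule.mem_bot] at hmem
  refine ⟨?_, ?_⟩
  · ext i j
    have := congrFun (congrFun (congrArg Prod.fst hmem) i) j
    simpa using this
  · ext i j
    have := congrFun (congrFun (congrArg Prod.snd hmem) i) j
    simpa using this

/-- Solutions of a continuous family of linear equations depend continuously on the parameter at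
a point where the solution is unique. -/
lemma continuousAt_of_linear_eq {W E F : Type*} [TopologicalSpace W] [AddCommGroup E]
    [Module ℝ E] [TopologicalSpace E] [IsTopologicalAddGroup E] [ContinuousSMul ℝ E] [T2Space E]
    [FiniteDimensional ℝ E] [AddCommGroup F] [Module ℝ F] [TopologicalSpace F]
    [IsTopologicalAddGroup F] [ContinuousSMul ℝ F] [T2Space F] [FiniteDimensional ℝ F] {w₀ : W}
    {L : W → E →ₗ[ℝ] F} (hL : ∀ e, ContinuousAt (fun w => L w e) w₀)
    (hinj : Function.Injective (L w₀)) {y : W → E} {c : F} (hy : ∀ᶠ w in 𝓝 w₀, L w (y w) = c) :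
    ContinuousAt y w₀ := by
  -- Composing with a left inverse at `w₀` gives square matrices `M w` with `M w₀ = 1`. They are
  -- invertible nearby, and Cramer's formula for `y w` is continuous.
  obtain ⟨G, hG⟩ := (L w₀).exists_leftInverse_of_injective (LinearMap.ker_eq_bot.2 hinj)
  let b := Module.finBasis ℝ E
  set M : W → Matrix _ _ ℝ := fun w => LinearMap.toMatrix b b (G ∘ₗ L w) with hM
  have hMc : ContinuousAt M w₀ := by
    refine continuousAt_pi.2 fun i => continuousAt_pi.2 fun j => ?_
    simp only [hM, LinearMap.toMatrix_apply, LinearMap.comp_apply]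
    have h1 : Continuous (b.coord i ∘ₗ G) := LinearMap.continuous_of_finiteDimensional _
    exact h1.continuousAt.comp (hL (b j))
  have hM0 : M w₀ = 1 := by simp only [hM, hG, LinearMap.toMatrix_id]
  have hdet : ContinuousAt (fun w => (M w).det) w₀ :=
    (continuous_id.matrix_det.continuousAt (x := M w₀)).comp hMc
  have hne : ∀ᶠ w in 𝓝 w₀, (M w).det ≠ 0 :=
    hdet.eventually_ne (by rw [hM0]; simp)
  have hinv : ContinuousAt (fun w => (M w)⁻¹) w₀ := by
    simp only [Matrix.inv_def, Ring.inverse_eq_inv']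
    refine ContinuousAt.smul (hdet.inv₀ (by rw [hM0]; simp)) ?_
    exact (continuous_id.matrix_adjugate.continuousAt (x := M w₀)).comp hMc
  have hsol : ∀ᶠ w in 𝓝 w₀, b.equivFun.symm ((M w)⁻¹ *ᵥ b.repr (G c)) = y w := by
    filter_upwards [hy, hne] with w h1 h2
    have h3 : M w *ᵥ b.repr (y w) = b.repr (G c) := by
      rw [hM, LinearMap.toMatrix_mulVec_repr, LinearMap.comp_apply, h1]
    rw [← h3, mulVec_mulVec, nonsing_inv_mul _ (isUnit_iff_ne_zero.2 h2), one_mulVec]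
    exact b.equivFun.symm_apply_apply (y w)
  refine ContinuousAt.congr ?_ hsol
  have h1 : Continuous b.equivFun.symm.toLinearMap := LinearMap.continuous_of_finiteDimensional _
  exact h1.continuousAt.comp (f := fun w => (M w)⁻¹ *ᵥ b.repr (G c)) (by fun_prop)

/-- The linear operator of the regulator equations. -/
def regulatorMap {n m p d : ℕ} (Ao : Matrix (Fin d) (Fin d) ℝ) (A : Matrix (Fin n) (Fin n) ℝ)
    (B : Matrix (Fin n) (Fin m) ℝ) (C : Matrix (Fin p) (Fin n) ℝ) :
    Matrix (Fin n) (Fin d) ℝ × Matrix (Fin m) (Fin d) ℝ →ₗ[ℝ]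
      Matrix (Fin n) (Fin d) ℝ × Matrix (Fin p) (Fin d) ℝ where
  toFun Y := (Y.1 * Ao - (A * Y.1 + B * Y.2), C * Y.1)
  map_add' Y Y' := by
    refine Prod.ext ?_ ?_
    · simp only [Prod.fst_add, Prod.snd_add, Matrix.add_mul, Matrix.mul_add]; abel
    · simp only [Prod.fst_add, Prod.snd_add, Matrix.mul_add]
  map_smul' c Y := by
    refine Prod.ext ?_ ?_ <;> simp [smul_sub, smul_add]

theorem continuousAt_regulator {n m p d : ℕ} {W : Type*} [TopologicalSpace W] {w₀ : W}
    {A : W → Matrix (Fin n) (Fin n) ℝ} {B : W → Matrix (Fin n) (Fin m) ℝ}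
    {C : W → Matrix (Fin p) (Fin n) ℝ} (hA : ContinuousAt A w₀) (hB : ContinuousAt B w₀)
    (hC : ContinuousAt C w₀) {Ao : Matrix (Fin d) (Fin d) ℝ} {Co : Matrix (Fin p) (Fin d) ℝ}
    (hZ : ZeroRankCondition Ao (A w₀) (B w₀) (C w₀)) {X : W → Matrix (Fin n) (Fin d) ℝ}
    {U : W → Matrix (Fin m) (Fin d) ℝ}
    (hXU : ∀ᶠ w in 𝓝 w₀, SolvesRegulator Ao Co (A w) (B w) (C w) (X w) (U w)) :
    ContinuousAt X w₀ ∧ ContinuousAt U w₀ := by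
  have h : ContinuousAt (fun w => (X w, U w)) w₀ := by
    refine continuousAt_of_linear_eq (L := fun w => regulatorMap Ao (A w) (B w) (C w))
      (c := (0, Co)) (fun e => ?_) ?_ ?_
    · simp only [regulatorMap, LinearMap.coe_mk, AddHom.coe_mk]
      fun_prop
    · rw [← LinearMap.ker_eq_bot, LinearMap.ker_eq_bot']
      rintro ⟨X', U'⟩ h0
      have h1 : X' * Ao - (A w₀ * X' + B w₀ * U') = 0 := congrArg Prod.fst h0
      have h2 : C w₀ * X' = 0 := congrArg Prod.snd h0
      obtain ⟨rfl, rfl⟩ := regulator_unique hZ (sub_eq_zero.1 h1) h2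
      rfl
    · filter_upwards [hXU] with w hw
      exact Prod.ext (sub_eq_zero.2 hw.1) hw.2.symm
  exact ⟨h.fst, h.snd⟩

end Regulator

/-! ### Continuity of block matrices -/

section BlockContinuity

variable {W ι κ ν ρ : Type*} [TopologicalSpace W] {w₀ : W}

lemma ContinuousAt.fromRows' {A : W → Matrix ι ρ ℝ} {B : W → Matrix κ ρ ℝ}
    (hA : ContinuousAt A w₀) (hB : ContinuousAt B w₀) :
    ContinuousAt (fun w => fromRows (A w) (B w)) w₀ := by
  refine continuousAt_pi.2 fun i => ?_
  rcases i with i | i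
  · exact continuousAt_pi.1 hA i
  · exact continuousAt_pi.1 hB i

lemma ContinuousAt.fromCols' {A : W → Matrix ρ ι ℝ} {B : W → Matrix ρ κ ℝ}
    (hA : ContinuousAt A w₀) (hB : ContinuousAt B w₀) :
    ContinuousAt (fun w => fromCols (A w) (B w)) w₀ := by
  refine continuousAt_pi.2 fun i => continuousAt_pi.2 fun j => ?_
  rcases j with j | j
  · exact continuousAt_pi.1 (continuousAt_pi.1 hA i) j
  · exact continuousAt_pi.1 (continuousAt_pi.1 hB i) j

lemma ContinuousAt.fromBlocks' {A : W → Matrix ι ν ℝ} {B : W → Matrix ι ρ ℝ}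
    {C : W → Matrix κ ν ℝ} {D : W → Matrix κ ρ ℝ} (hA : ContinuousAt A w₀)
    (hB : ContinuousAt B w₀) (hC : ContinuousAt C w₀) (hD : ContinuousAt D w₀) :
    ContinuousAt (fun w => fromBlocks (A w) (B w) (C w) (D w)) w₀ := by
  simp only [← fromRows_fromCols_eq_fromBlocks]
  exact (hA.fromCols' hB).fromRows' (hC.fromCols' hD)

lemma ContinuousAt.toCols₁' {A : W → Matrix ρ (ι ⊕ κ) ℝ} (hA : ContinuousAt A w₀) :
    ContinuousAt (fun w => (A w).toCols₁) w₀ :=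
  continuousAt_pi.2 fun i => continuousAt_pi.2 fun j =>
    continuousAt_pi.1 (continuousAt_pi.1 hA i) (Sum.inl j)

lemma ContinuousAt.toCols₂' {A : W → Matrix ρ (ι ⊕ κ) ℝ} (hA : ContinuousAt A w₀) :
    ContinuousAt (fun w => (A w).toCols₂) w₀ :=
  continuousAt_pi.2 fun i => continuousAt_pi.2 fun j =>
    continuousAt_pi.1 (continuousAt_pi.1 hA i) (Sum.inr j)

lemma ContinuousAt.imUpsilon {d m : ℕ} {U : W → Matrix (Fin m) (Fin d) ℝ}
    (hU : ContinuousAt U w₀) (Ao : Matrix (Fin d) (Fin d) ℝ) :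
    ContinuousAt (fun w => imUpsilon Ao (U w)) w₀ := by
  refine continuousAt_pi.2 fun jk => continuousAt_pi.2 fun c => ?_
  have h : ContinuousAt (fun w => U w * Ao ^ (jk.2 : ℕ)) w₀ := by fun_prop
  exact continuousAt_pi.1 (continuousAt_pi.1 h jk.1) c

end BlockContinuity

/-! ### The nominal closed loop and the main theorem -/

section ClosedLoop

variable {ι κ ν ρ o : Type*} [Fintype κ]

lemma uncertainty_self [Fintype ν] {n m d q : ℕ} (A : Matrix (Fin n) (Fin n) ℝ)
    (B : Matrix (Fin n) (Fin m) ℝ) (X : Matrix (Fin n) (Fin d) ℝ) (Υ : Matrix ν (Fin d) ℝ) (T : Matrix ν ν ℝ)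
    (Q : Matrix (Fin m) ν ℝ) (E : Matrix (Fin d) (Fin q) ℝ) :
    uncertainty A A B B X X Υ Υ T Q E = 0 := by
  simp [uncertainty]

/-- Full-state feedback through the internal model. -/
lemma augA_add_augB_mul (A : Matrix ι ι ℝ) (B : Matrix ι κ ℝ) (M : Matrix ν ν ℝ)
    (N : Matrix ν κ ℝ) (Q : Matrix κ ν ℝ) (K : Matrix κ ι ℝ) :
    augA A B M N Q + augB B N * fromCols K (-Q) = fromBlocks (A + B * K) 0 (N * K) M := by
  rw [augA, augB, fromRows_mul_fromCols, fromBlocks_add]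
  simp

/-- The separation principle: without uncertainty the observer does not change the gain. -/
lemma StrictGain.observer [Fintype ι] [DecidableEq ι] [Fintype ρ] [Fintype o]
    {A : Matrix ι ι ℝ} {B : Matrix ι κ ℝ} {R : Matrix ι ρ ℝ}
    {C : Matrix o ι ℝ} {K : Matrix κ ι ℝ} {a b : ℝ} (h : StrictGain (A + B * K) R C a b)
    {L : Matrix ι o ℝ} (hL : IsHurwitz (A - L * C)) :
    StrictGain (closedA A B C (0 : Matrix ι (ι ⊕ (κ ⊕ ρ)) ℝ) 0 K L)
      (closedR R (0 : Matrix ι (ι ⊕ (κ ⊕ ρ)) ℝ)) (closedC C 0) a b := by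
  have h1 : (0 : Matrix ι (ι ⊕ (κ ⊕ ρ)) ℝ).toCols₁ = 0 := rfl
  have h2 : (0 : Matrix ι (ι ⊕ (κ ⊕ ρ)) ℝ).toCols₂ = 0 := rfl
  have h3 : (0 : Matrix ι (κ ⊕ ρ) ℝ).toCols₁ = 0 := rfl
  have h4 : (0 : Matrix ι (κ ⊕ ρ) ℝ).toCols₂ = 0 := rfl
  -- Coordinates `(x, x - χ)`, an involution. Plant and observer receive the same `R ζ`, so it
  -- cancels in the error.
  refine (h.cascade_driven (-(B * K)) hL.hasLyapunov).of_similar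
    (fromBlocks 1 0 1 (-1)) (fromBlocks 1 0 1 (-1)) ?_ ?_ ?_ ?_
  · rw [fromBlocks_multiply, ← fromBlocks_one]
    simp
  · rw [closedA, h1, h2, h3, fromBlocks_multiply, fromBlocks_multiply]
    simp [sub_eq_add_neg]
  · rw [closedR, h2, h4, fromBlocks_mul_fromRows]
    simp
  · rw [closedC, fromCols_mul_fromBlocks]
    simp

end ClosedLoop

theorem mainTheorem7 {n m p d q r h : ℕ}
    -- the uncertain agent `ẋ = A(w) x + B(w) u`, `y = C(w) x`, with nominal value `w = 0`
    (A : EuclideanSpace ℝ (Fin r) → Matrix (Fin n) (Fin n) ℝ)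
    (B : EuclideanSpace ℝ (Fin r) → Matrix (Fin n) (Fin m) ℝ)
    (C : EuclideanSpace ℝ (Fin r) → Matrix (Fin p) (Fin n) ℝ)
    (hA : ContinuousAt A 0) (hB : ContinuousAt B 0) (hC : ContinuousAt C 0)
    -- a pseudo-inverse `B⁺` of the nominal input matrix
    (Bp : Matrix (Fin m) (Fin n) ℝ) (hBp : Bp * B 0 = 1)
    -- the pattern `(Ao, Co)` and the matrices of `v̇ = Ao v + Bo Cζ ζ`
    (Ao : Matrix (Fin d) (Fin d) ℝ) (Co : Matrix (Fin p) (Fin d) ℝ)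
    (Bo : Matrix (Fin d) (Fin h) ℝ) (Cζ : Matrix (Fin h) (Fin q) ℝ)
    -- the standing rank condition and the solution of the regulator equations, for `w` near `0`
    (hZ : ∀ᶠ w in 𝓝 0, ZeroRankCondition Ao (A w) (B w) (C w))
    (X : EuclideanSpace ℝ (Fin r) → Matrix (Fin n) (Fin d) ℝ)
    (U : EuclideanSpace ℝ (Fin r) → Matrix (Fin m) (Fin d) ℝ)
    (hXU : ∀ᶠ w in 𝓝 0, SolvesRegulator Ao Co (A w) (B w) (C w) (X w) (U w))
    -- the assumption on the nominal system
    (hctrb : IsControllable (A 0) (B 0))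
    (hdet : IsDetectable (A 0) (C 0))
    (hlevel : ∀ j ∈ Finset.Icc 1 (numSVDSteps (A 0) (B 0)), C 0 * A 0 ^ (j - 1) * B 0 = 0)
    -- the internal model and the nonsingular solution `T` of the Sylvester equation
    (M : Matrix (Fin m × Fin (minDeg Ao)) (Fin m × Fin (minDeg Ao)) ℝ)
    (N : Matrix (Fin m × Fin (minDeg Ao)) (Fin m) ℝ)
    (hM : IsHurwitz M) (hMN : IsControllable M N)
    (T : Matrix (Fin m × Fin (minDeg Ao)) (Fin m × Fin (minDeg Ao)) ℝ)
    (hT : IsUnit T.det) (hSyl : T * imPhi m Ao - M * T = N * imPsi m Ao)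
    (γ : ℝ) (hγ : 0 < γ) :
    ∃ K : Matrix (Fin m) (Fin n) ℝ,
      -- `u = K x` solves the `γ`-stabilization problem of the nominal `(A, B, C, R)`
      HasExternalGain (A 0 + B 0 * K) (-(X 0 * Bo * Cζ)) (C 0) γ ∧
      -- there are gains `L` with `Ā - L C̄` Hurwitz, and the controller works for each of them
      (∃ L : Matrix (Fin n ⊕ Fin m × Fin (minDeg Ao)) (Fin p) ℝ,
        IsHurwitz (augA (A 0) (B 0) M N (imPsi m Ao * T⁻¹) - L * augC _ (C 0))) ∧
      ∀ L : Matrix (Fin n ⊕ Fin m × Fin (minDeg Ao)) (Fin p) ℝ,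
        IsHurwitz (augA (A 0) (B 0) M N (imPsi m Ao * T⁻¹) - L * augC _ (C 0)) →
        ∃ W ∈ 𝓝 (0 : EuclideanSpace ℝ (Fin r)), ∀ w ∈ W,
          HasExternalGain
            (closedA (augA (A 0) (B 0) M N (imPsi m Ao * T⁻¹)) (augB (B 0) N) (augC _ (C 0))
              (uncertainty (A 0) (A w) (B 0) (B w) (X 0) (X w)
                (imUpsilon Ao (U 0)) (imUpsilon Ao (U w)) T (imPsi m Ao * T⁻¹) (Bo * Cζ))
              (augC _ (C w - C 0))
              (fromCols K (-(imPsi m Ao * T⁻¹))) L)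
            (closedR (augR N Bp (-(X 0 * Bo * Cζ)))
              (uncertainty (A 0) (A w) (B 0) (B w) (X 0) (X w)
                (imUpsilon Ao (U 0)) (imUpsilon Ao (U w)) T (imPsi m Ao * T⁻¹) (Bo * Cζ)))
            (closedC (augC _ (C 0)) (augC _ (C w - C 0)))
            γ := by
  obtain ⟨K, hK⟩ := hctrb.SVDStepsTo_numSVDSteps.exists_strictGain (C 0) (-(X 0 * Bo * Cζ))
    (fun i hi => by simpa using hlevel (i + 1) (Finset.mem_Icc.2 ⟨by omega, hi⟩)) hγ
  obtain ⟨hX, hU⟩ := continuousAt_regulator hA hB hC hZ.self_of_nhds hXU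
  refine ⟨K, hK.hasExternalGain hγ, isDetectable_aug hZ.self_of_nhds hdet hT hSyl, fun L hL => ?_⟩
  set Q := imPsi m Ao * T⁻¹
  have hΔ : ContinuousAt (fun w => uncertainty (A 0) (A w) (B 0) (B w) (X 0) (X w)
      (imUpsilon Ao (U 0)) (imUpsilon Ao (U w)) T Q (Bo * Cζ)) 0 := by
    have hΥ := hU.imUpsilon Ao
    refine ContinuousAt.fromCols' (.fromBlocks' ?_ ?_ ?_ ?_) (.fromBlocks' ?_ ?_ ?_ ?_) <;> fun_prop
  have hΔ' : ContinuousAt (fun w => augC (Fin m × Fin (minDeg Ao)) (C w - C 0)) 0 :=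
    ContinuousAt.fromCols' (by fun_prop) (by fun_prop)
  -- The term `-Q` cancels `B Q` and `N Q`. The loop becomes block triangular, with `M` driven by
  -- the plant and absent from the output.
  have hfb : StrictGain (augA (A 0) (B 0) M N Q + augB (B 0) N * fromCols K (-Q))
      (augR N Bp (-(X 0 * Bo * Cζ))) (augC _ (C 0)) 1 γ := by
    rw [augA_add_augB_mul]
    exact hK.cascade_driving (N * K) (N * Bp * -(X 0 * Bo * Cζ)) hM.hasLyapunov
  have h0 := hfb.observer hL
  -- At `w = 0` the uncertainty vanishes and the separation result applies; the margin covers nearby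
  -- `w`.
  have hcl := StrictGain.eventually (w₀ := (0 : EuclideanSpace ℝ (Fin r)))
    (A := fun w => closedA (augA (A 0) (B 0) M N Q) (augB (B 0) N) (augC _ (C 0))
      (uncertainty (A 0) (A w) (B 0) (B w) (X 0) (X w)
        (imUpsilon Ao (U 0)) (imUpsilon Ao (U w)) T Q (Bo * Cζ))
      (augC _ (C w - C 0)) (fromCols K (-Q)) L)
    (R := fun w => closedR (augR N Bp (-(X 0 * Bo * Cζ)))
      (uncertainty (A 0) (A w) (B 0) (B w) (X 0) (X w)
        (imUpsilon Ao (U 0)) (imUpsilon Ao (U w)) T Q (Bo * Cζ)))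
    (C := fun w => closedC (augC _ (C 0)) (augC _ (C w - C 0))) (a := 1) (b := γ)
    (by
      have h1 := hΔ.toCols₁'
      have h2 := hΔ.toCols₂'.toCols₁'
      refine ContinuousAt.fromBlocks' ?_ ?_ ?_ ?_ <;> fun_prop)
    (by
      have h2 := hΔ.toCols₂'.toCols₂'
      refine ContinuousAt.fromRows' ?_ ?_ <;> fun_prop)
    (by
      refine ContinuousAt.fromCols' ?_ ?_ <;> fun_prop)
    (by
      have hC0 : augC (Fin m × Fin (minDeg Ao)) (C 0 - C 0) = 0 := by simp [augC]
      simp only [uncertainty_self, hC0]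
      exact h0)
  exact ⟨_, hcl, fun w hw => StrictGain.hasExternalGain hγ hw⟩
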